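/- Let $n\ge 2$ and $\alpha=(\alpha_1,\dots,\alpha_n)$ with $\alpha_k\in(-\pi,\pi)\setminus\{0\}$ for all $k$. Put $$K_\alpha(\mathbf x,\mathbf a)=\prod_{k=1}^n C_{\alpha_k}\,e^{\,i\left(\frac{x_k^2+a_k^2}{2}\cot\alpha_k-x_ka_k\csc\alpha_k\right)},\qquad C_{\alpha_k}=\sqrt{\tfrac{1-i\cot\alpha_k}{2\pi}}$$ (principal branch), and for $f\in\mathcal S(\mathbb R^n)$, $\psi\in\mathcal S(\mathbb R)$ define the directional short-time fractional Fourier transform $$DS_\psi^\alpha f(\mathbf u,b,\mathbf a)=\int_{\mathbb R^n} f(\mathbf x)\,\overline{\psi(\mathbf u\cdot\mathbf x-b)}\,K_\alpha(\mathbf x,\mathbf a)\,d\mathbf x,\qquad(\mathbf u,b,\mathbf a)\in\mathbb Y^{2n}=\mathbb S^{n-1}\times\mathbb R\times\mathbb R^n .$$ Let $\mathcal S(\mathbb Y^{2n})$ be the space of all $\Phi\in C^\infty(\mathbb Y^{2n})$ such that $$\rho_{s,r}^{l,m,k}(\Phi)=\sup_{(\mathbf u,b,\mathbf a)\in\mathbb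 Y^{2n}}(1+|b|^2)^{r/2}(1+|\mathbf a|^2)^{s/2}\left|\partial_{\mathbf a}^{l}\partial_b^{m}\Delta_{\mathbf u}^{k}\Phi(\mathbf u,b,\mathbf a)\right|<\infty$$ for all $s,r,m,k\in\mathbb N_0$, $l\in\mathbb N_0^n$, where $\Delta_{\mathbf u}$ is the Laplace–Beltrami operator on $\mathbb S^{n-1}$; its topology is defined by these seminorms. The topology of $\mathcal S(\mathbb R^d)$ is defined by the seminorms $\rho_v(\varphi)=\sup_{\mathbf x\in\mathbb R^d,\,|\beta|\le v}(1+|\mathbf x|)^v|\partial^\beta\varphi(\mathbf x)|$, $v\in\mathbb N_0$. **Theorem.** For all $f\in\mathcal S(\mathbb R^n)$ and $\psi\in\mathcal S(\mathbb R)$ the function $DS_\psi^\alpha f$ belongs to $\mathcal S(\mathbb Y^{2n})$, and the map $$\mathcal S(\mathbb R^n)\times\mathcal S(\mathbb R)\to\mathcal S(\mathbb Y^{2n}),\qquad (f,\psi)\mapsto DS_\psi^\alpha f,$$ which is linear in $f$ and conjugate-linear in $\psi$, is (jointly) continuous. Moreover, for all $s,r,m,k\in\mathbb N_0$ and $l\in\mathbb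 N_0^n$ there exist $v,\tau\in\mathbb N_0$ and $C>0$ such that $$\rho_{s,r}^{l,m,k}(DS_\psi^\alpha f)\le C\,\rho_v(f)\,\rho_\tau(\psi)\qquad\text{for all } f\in\mathcal S(\mathbb R^n),\ \psi\in\mathcal S(\mathbb R).$$ -/

import Mathlib

open scoped ContDiff Manifold SchwartzMap ComplexConjugate
open Metric Module

noncomputable section

/-- The Euclidean space `ℝⁿ`. -/
abbrev Rn (n : ℕ) : Type := EuclideanSpace ℝ (Fin n)

/-- The unit sphere `𝕊ⁿ⁻¹ ⊂ ℝⁿ`. -/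
abbrev USphere (n : ℕ) : Type := sphere (0 : Rn n) 1

/-- The phase space `𝕐²ⁿ = 𝕊ⁿ⁻¹ × ℝ × ℝⁿ`; its points are `(u, b, a)`. -/
abbrev PhaseY (n : ℕ) : Type := USphere n × ℝ × Rn n

instance factFinrankRn (n : ℕ) [n.AtLeastTwo] : Fact (finrank ℝ (Rn n) = (n - 1) + 1) :=
  ⟨by have := Nat.AtLeastTwo.prop (n := n); simp only [finrank_euclideanSpace_fin]; omega⟩

/-! ### Differential operators -/

/-- The partial derivative `∂g/∂xᵢ` of a function on `ℝⁿ`. -/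
def partialD {n : ℕ} (i : Fin n) (g : Rn n → ℂ) : Rn n → ℂ :=
  fun x => fderiv ℝ g x (EuclideanSpace.single i 1)

/-- The mixed partial derivative `∂ˡ g = ∂₁^{l₁} ⋯ ∂ₙ^{lₙ} g` for a multi-index `l ∈ ℕ₀ⁿ`. -/
def multiDeriv {n : ℕ} (l : Fin n → ℕ) (g : Rn n → ℂ) : Rn n → ℂ :=
  (List.finRange n).foldr (fun i h => (partialD i)^[l i] h) g

/-- The extension `x ↦ g (x / |x|)` of a function on the sphere to `ℝⁿ \ {0}`, homogeneous of
degree `0` (the value at the origin is set to `0` and is irrelevant). -/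
def radialExt {n : ℕ} (g : USphere n → ℂ) : Rn n → ℂ :=
  fun x => Function.extend Subtype.val g 0 (‖x‖⁻¹ • x)

/-- The Laplace–Beltrami operator of the round unit sphere: the Euclidean Laplacian of the
extension of `g` which is homogeneous of degree `0`, restricted to the sphere. -/
def sphereLaplacian {n : ℕ} (g : USphere n → ℂ) : USphere n → ℂ :=
  fun u => Laplacian.laplacian (radialExt g) (u : Rn n)

/-- The derivative `∂ₐˡ ∂_bᵐ Δᵤᵏ Φ` of a function on `𝕐²ⁿ`. -/
def mixedDerivY {n : ℕ} (l : Fin n → ℕ) (m k : ℕ) (Φ : PhaseY n → ℂ) : PhaseY n → ℂ :=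
  fun p => multiDeriv l (fun a => iteratedDeriv m (fun b =>
    sphereLaplacian^[k] (fun u => Φ (u, b, a)) p.1) p.2.1) p.2.2

/-- `Φ ∈ C^∞(𝕐²ⁿ)`, for the product manifold structure of `𝕊ⁿ⁻¹ × ℝ × ℝⁿ`. -/
def SmoothY {n : ℕ} [n.AtLeastTwo] (Φ : PhaseY n → ℂ) : Prop :=
  ContMDiff ((𝓡 (n - 1)).prod (𝓘(ℝ, ℝ).prod 𝓘(ℝ, Rn n))) 𝓘(ℝ, ℂ) ∞ Φ

/-- The quantity `(1+|b|²)^{r/2} (1+|a|²)^{s/2} |∂ₐˡ ∂_bᵐ Δᵤᵏ Φ(u,b,a)|`. -/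
def weightedDerivY {n : ℕ} (s r : ℕ) (l : Fin n → ℕ) (m k : ℕ) (Φ : PhaseY n → ℂ)
    (p : PhaseY n) : ℝ :=
  (1 + |p.2.1| ^ 2) ^ ((r : ℝ) / 2) * (1 + ‖p.2.2‖ ^ 2) ^ ((s : ℝ) / 2) *
    ‖mixedDerivY l m k Φ p‖

/-! ### Preservation of smoothness (needed for the linear structure of `𝒮(𝕐²ⁿ)`) -/

section Smoothness

variable {n : ℕ}

theorem two_le_infty : (2 : ℕ∞ω) ≤ ∞ := WithTop.coe_le_coe.2 (le_top : (2 : ℕ∞) ≤ ⊤)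

theorem radialExt_coe (g : USphere n → ℂ) (u : USphere n) : radialExt g u = g u := by
  have hu : ‖(u : Rn n)‖ = 1 := by simp
  simp only [radialExt, hu, inv_one, one_smul]
  exact Subtype.val_injective.extend_apply g 0 u

theorem radialExt_of_ne (g : USphere n → ℂ) {x : Rn n} (hx : x ≠ 0) :
    radialExt g x = g ⟨‖x‖⁻¹ • x, by simp [norm_smul, hx]⟩ :=
  Subtype.val_injective.extend_apply g 0 (⟨‖x‖⁻¹ • x, by simp [norm_smul, hx]⟩ : USphere n)

theorem radialExt_add (g h : USphere n → ℂ) :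
    radialExt (g + h) = radialExt g + radialExt h := by
  funext x
  have := Function.extend_add (Subtype.val : USphere n → Rn n) g h 0 0
  simp only [add_zero] at this
  simp [radialExt, this]

theorem radialExt_smul (c : ℂ) (g : USphere n → ℂ) :
    radialExt (c • g) = c • radialExt g := by
  funext x
  have := Function.extend_smul c (Subtype.val : USphere n → Rn n) g 0
  simp only [smul_zero] at this
  simp [radialExt, this]

/-- The extension of `Φ` to `(ℝⁿ \ {0}) × ℝ × ℝⁿ`, homogeneous of degree `0` in `u`. -/
def extY (Φ : PhaseY n → ℂ) : Rn n × ℝ × Rn n → ℂ :=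
  fun p => radialExt (fun u => Φ (u, p.2)) p.1

theorem isOpen_domY : IsOpen {p : Rn n × ℝ × Rn n | p.1 ≠ 0} :=
  isOpen_ne.preimage continuous_fst

open Classical in
/-- The projection `x ↦ x / |x|` onto the sphere (with the value `v` at the origin). -/
def sphProj (v : USphere n) (x : Rn n) : USphere n :=
  if hx : x = 0 then v else ⟨‖x‖⁻¹ • x, by simp [norm_smul, hx]⟩

theorem sphProj_coe (v : USphere n) {x : Rn n} (hx : x ≠ 0) :
    (sphProj v x : Rn n) = ‖x‖⁻¹ • x := by simp [sphProj, hx]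

theorem fderiv_slice {F : Rn n × ℝ × Rn n → ℂ} {x : Rn n} {q : ℝ × Rn n}
    (hF : DifferentiableAt ℝ F (x, q)) (e : Rn n) :
    fderiv ℝ (fun y => F (y, q)) x e = fderiv ℝ F (x, q) (e, 0) := by
  have h' : HasFDerivAt (fun y => F (y, q)) _ x :=
    hF.hasFDerivAt.comp (f := fun y : Rn n => (y, q)) x
      ((hasFDerivAt_id x).prodMk (hasFDerivAt_const q x))
  rw [h'.fderiv]
  simp

theorem extY_coe (Φ : PhaseY n → ℂ) (u : USphere n) (q : ℝ × Rn n) :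
    extY Φ ((u : Rn n), q) = Φ (u, q) := radialExt_coe _ u

variable [n.AtLeastTwo]

theorem SmoothY.of_contDiffOn {Φ : PhaseY n → ℂ} {G : Rn n × ℝ × Rn n → ℂ}
    (hG : ContDiffOn ℝ ∞ G {p | p.1 ≠ 0}) (h : ∀ p : PhaseY n, Φ p = G ((p.1 : Rn n), p.2)) :
    SmoothY Φ := by
  have e : Φ = G ∘ fun p : PhaseY n => ((p.1 : Rn n), p.2.1, p.2.2) := funext h
  rw [SmoothY, e]
  have h1 : ContMDiff ((𝓡 (n - 1)).prod (𝓘(ℝ, ℝ).prod 𝓘(ℝ, Rn n))) 𝓘(ℝ, Rn n) ∞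
      (fun p : PhaseY n => (p.1 : Rn n)) :=
    contMDiff_coe_sphere.comp contMDiff_fst
  have h2 : ContMDiff ((𝓡 (n - 1)).prod (𝓘(ℝ, ℝ).prod 𝓘(ℝ, Rn n))) 𝓘(ℝ, ℝ) ∞
      (fun p : PhaseY n => p.2.1) := contMDiff_fst.comp contMDiff_snd
  have h3 : ContMDiff ((𝓡 (n - 1)).prod (𝓘(ℝ, ℝ).prod 𝓘(ℝ, Rn n))) 𝓘(ℝ, Rn n) ∞
      (fun p : PhaseY n => p.2.2) := contMDiff_snd.comp contMDiff_snd
  exact hG.contMDiffOn.comp_contMDiff (h1.prodMk_space (h2.prodMk_space h3))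
    fun p => ne_zero_of_mem_unit_sphere p.1

theorem contMDiffAt_sphProj (v : USphere n) {x : Rn n} (hx : x ≠ 0) :
    ContMDiffAt 𝓘(ℝ, Rn n) (𝓡 (n - 1)) ∞ (sphProj v) x := by
  have hs : ∀ᶠ y in nhds x, y ≠ (0 : Rn n) := isOpen_ne.mem_nhds hx
  have hf : ContDiffAt ℝ ∞ (fun y : Rn n => ‖y‖⁻¹ • y) x :=
    ((contDiffAt_norm ℝ hx).inv (by simpa using hx)).smul contDiffAt_id
  have hval : (fun y => (sphProj v y : Rn n)) =ᶠ[nhds x] fun y => ‖y‖⁻¹ • y := by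
    filter_upwards [hs] with y hy using sphProj_coe v hy
  have hf' : ContDiffAt ℝ ∞ (fun y => (sphProj v y : Rn n)) x := hf.congr_of_eventuallyEq hval
  rw [contMDiffAt_iff_target]
  refine ⟨Topology.IsInducing.subtypeVal.continuousAt_iff.2 hf'.continuousAt, ?_⟩
  set w := sphProj v x with hw
  let U : _ ≃ₗᵢ[ℝ] _ :=
    (OrthonormalBasis.fromOrthogonalSpanSingleton (𝕜 := ℝ)
      (n - 1) (ne_zero_of_mem_unit_sphere (-w))).repr
  have h1 : ContDiffAt ℝ ∞ (stereoToFun ((-w : USphere n) : Rn n)) (w : Rn n) := by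
    refine (contDiffOn_stereoToFun (n := ∞)).contDiffAt (IsOpen.mem_nhds ?_ ?_)
    · exact isOpen_ne.preimage (by fun_prop)
    · have hw1 : ‖(w : Rn n)‖ = 1 := by simp
      simp [hw1]
      norm_num
  have h2 : ContDiffAt ℝ ∞
      (fun y => U (stereoToFun ((-w : USphere n) : Rn n) (sphProj v y : Rn n))) x :=
    U.contDiff.contDiffAt.comp x
      (ContDiffAt.comp (g := stereoToFun ((-w : USphere n) : Rn n)) x h1 hf')
  exact h2.contMDiffAt

theorem SmoothY.contDiffOn_extY {Φ : PhaseY n → ℂ} (h : SmoothY Φ) :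
    ContDiffOn ℝ ∞ (extY Φ) {p | p.1 ≠ 0} := by
  intro p hp
  have hp' : p.1 ≠ 0 := hp
  let v : USphere n := ⟨‖p.1‖⁻¹ • p.1, by simp [norm_smul, hp']⟩
  have h1 : ContMDiffAt 𝓘(ℝ, Rn n × ℝ × Rn n) (𝓡 (n - 1)) ∞
      (fun q : Rn n × ℝ × Rn n => sphProj v q.1) p :=
    (contMDiffAt_sphProj v hp').comp p contDiff_fst.contMDiff.contMDiffAt
  have h2 : ContMDiffAt 𝓘(ℝ, Rn n × ℝ × Rn n) 𝓘(ℝ, ℝ) ∞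
      (fun q : Rn n × ℝ × Rn n => q.2.1) p :=
    (contDiff_fst.comp contDiff_snd).contMDiff.contMDiffAt
  have h3 : ContMDiffAt 𝓘(ℝ, Rn n × ℝ × Rn n) 𝓘(ℝ, Rn n) ∞
      (fun q : Rn n × ℝ × Rn n => q.2.2) p :=
    (contDiff_snd.comp contDiff_snd).contMDiff.contMDiffAt
  have h4 := (h.contMDiffAt (x := (sphProj v p.1, p.2.1, p.2.2))).comp p
    (h1.prodMk (h2.prodMk h3))
  refine (h4.contDiffAt.congr_of_eventuallyEq ?_).contDiffWithinAt
  filter_upwards [isOpen_domY.mem_nhds hp] with q hq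
  have hq' : q.1 ≠ 0 := hq
  simp only [extY, radialExt_of_ne _ hq', Function.comp_apply]
  congr 1
  simp [sphProj, hq']

theorem contDiffOn_fderiv_apply {V : Type*} [NormedAddCommGroup V] [NormedSpace ℝ V]
    {F : V → ℂ} {s : Set V} (hs : IsOpen s) (hF : ContDiffOn ℝ ∞ F s) (w : V) :
    ContDiffOn ℝ ∞ (fun p => fderiv ℝ F p w) s :=
  (hF.fderiv_of_isOpen hs (by simp)).clm_apply contDiffOn_const

theorem SmoothY.contDiffAt_radialExt {Φ : PhaseY n → ℂ} (h : SmoothY Φ) (q : ℝ × Rn n)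
    {x : Rn n} (hx : x ≠ 0) : ContDiffAt ℝ ∞ (radialExt fun u => Φ (u, q)) x :=
  (h.contDiffOn_extY.contDiffAt (isOpen_domY.mem_nhds (show (x, q) ∈ _ from hx))).comp
    (f := fun y : Rn n => (y, q)) x (contDiffAt_id.prodMk contDiffAt_const)

theorem sphereLaplacian_slice {Φ : PhaseY n → ℂ} (h : SmoothY Φ) (p : PhaseY n) :
    sphereLaplacian (fun u => Φ (u, p.2)) p.1 =
      ∑ i, fderiv ℝ (fun q => fderiv ℝ (extY Φ) q (stdOrthonormalBasis ℝ (Rn n) i, 0))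
        ((p.1 : Rn n), p.2) (stdOrthonormalBasis ℝ (Rn n) i, 0) := by
  have hp : (p.1 : Rn n) ≠ 0 := ne_zero_of_mem_unit_sphere p.1
  have hF := h.contDiffOn_extY
  have hd : ∀ q : Rn n × ℝ × Rn n, q.1 ≠ 0 → DifferentiableAt ℝ (extY Φ) q := fun q hq =>
    (hF.contDiffAt (isOpen_domY.mem_nhds hq)).differentiableAt (by simp)
  have hx := h.contDiffAt_radialExt p.2 hp
  rw [_root_.sphereLaplacian,
    InnerProductSpace.laplacian_eq_iteratedFDeriv_stdOrthonormalBasis]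
  refine Finset.sum_congr rfl fun i _ => ?_
  set e := stdOrthonormalBasis ℝ (Rn n) i
  rw [iteratedFDeriv_two_apply]
  simp only [Matrix.cons_val_zero, Matrix.cons_val_one]
  have hd1 : DifferentiableAt ℝ (fderiv ℝ (radialExt fun u => Φ (u, p.2))) (p.1 : Rn n) :=
    (hx.fderiv_right (m := 1)
      (one_add_one_eq_two.trans_le two_le_infty)).differentiableAt (by simp)
  have e1 : fderiv ℝ (fderiv ℝ (radialExt fun u => Φ (u, p.2))) (p.1 : Rn n) e e =
      fderiv ℝ (fun y => fderiv ℝ (radialExt fun u => Φ (u, p.2)) y e) (p.1 : Rn n) e := by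
    rw [fderiv_clm_apply hd1 (differentiableAt_const e)]
    simp
  have e2 : (fun y => fderiv ℝ (radialExt fun u => Φ (u, p.2)) y e) =ᶠ[nhds (p.1 : Rn n)]
      fun y => fderiv ℝ (extY Φ) (y, p.2) (e, 0) := by
    filter_upwards [isOpen_ne.mem_nhds hp] with y hy
    exact fderiv_slice (F := extY Φ) (hd (y, p.2) hy) e
  rw [e1, e2.fderiv_eq]
  have h2 := contDiffOn_fderiv_apply isOpen_domY hF (e, 0)
  exact fderiv_slice (F := fun q => fderiv ℝ (extY Φ) q (e, 0))
    ((h2.contDiffAt (isOpen_domY.mem_nhds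
      (show ((p.1 : Rn n), p.2) ∈ _ from hp))).differentiableAt (by simp)) e

theorem SmoothY.sphereLaplacian {Φ : PhaseY n → ℂ} (h : SmoothY Φ) :
    SmoothY fun p : PhaseY n => sphereLaplacian (fun u => Φ (u, p.2)) p.1 := by
  refine .of_contDiffOn (G := fun p => ∑ i,
    fderiv ℝ (fun q => fderiv ℝ (extY Φ) q (stdOrthonormalBasis ℝ (Rn n) i, 0))
        p (stdOrthonormalBasis ℝ (Rn n) i, 0)) ?_ (sphereLaplacian_slice h)
  exact ContDiffOn.sum fun i _ => contDiffOn_fderiv_apply isOpen_domY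
    (contDiffOn_fderiv_apply isOpen_domY h.contDiffOn_extY _) _

theorem SmoothY.iterate_sphereLaplacian {Φ : PhaseY n → ℂ} (h : SmoothY Φ) (k : ℕ) :
    SmoothY fun p : PhaseY n => _root_.sphereLaplacian^[k] (fun u => Φ (u, p.2)) p.1 := by
  induction k with
  | zero => exact h
  | succ k ih =>
    simp only [Function.iterate_succ_apply']
    exact ih.sphereLaplacian

theorem SmoothY.contDiffAt_extY {Φ : PhaseY n → ℂ} (h : SmoothY Φ) (p : PhaseY n) :
    ContDiffAt ℝ ∞ (extY Φ) ((p.1 : Rn n), p.2) :=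
  h.contDiffOn_extY.contDiffAt (isOpen_domY.mem_nhds
    (show ((p.1 : Rn n), p.2) ∈ _ from ne_zero_of_mem_unit_sphere p.1))

theorem SmoothY.contDiff_snd {Φ : PhaseY n → ℂ} (h : SmoothY Φ) (u : USphere n) :
    ContDiff ℝ ∞ fun q : ℝ × Rn n => Φ (u, q) := by
  rw [contDiff_iff_contDiffAt]
  intro q
  have := (h.contDiffAt_extY (u, q)).comp (f := fun q : ℝ × Rn n => ((u : Rn n), q)) q
    (contDiffAt_const.prodMk contDiffAt_id)
  exact this.congr_of_eventuallyEq (.of_forall fun q => (extY_coe Φ u q).symm)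

theorem SmoothY.deriv {Φ : PhaseY n → ℂ} (h : SmoothY Φ) :
    SmoothY fun p : PhaseY n => _root_.deriv (fun b => Φ (p.1, b, p.2.2)) p.2.1 := by
  refine .of_contDiffOn (contDiffOn_fderiv_apply isOpen_domY h.contDiffOn_extY (0, 1, 0))
    fun p => ?_
  have h1 : HasDerivAt (fun b : ℝ => ((p.1 : Rn n), b, p.2.2)) (0, 1, 0) p.2.1 :=
    (hasDerivAt_const _ _).prodMk ((hasDerivAt_id _).prodMk (hasDerivAt_const _ _))
  have h2 := ((h.contDiffAt_extY p).differentiableAt (by simp)).hasFDerivAt.comp_hasDerivAt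
    (f := fun b : ℝ => ((p.1 : Rn n), b, p.2.2)) p.2.1 h1
  have h3 : (extY Φ ∘ fun b : ℝ => ((p.1 : Rn n), b, p.2.2)) = fun b => Φ (p.1, b, p.2.2) :=
    funext fun b => extY_coe Φ p.1 _
  rw [h3] at h2
  exact h2.deriv

theorem SmoothY.iteratedDeriv {Φ : PhaseY n → ℂ} (h : SmoothY Φ) (m : ℕ) :
    SmoothY fun p : PhaseY n =>
      _root_.iteratedDeriv m (fun b => Φ (p.1, b, p.2.2)) p.2.1 := by
  induction m with
  | zero => simpa only [iteratedDeriv_zero] using h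
  | succ m ih =>
    simp only [iteratedDeriv_succ]
    exact ih.deriv

theorem SmoothY.add {Φ Ψ : PhaseY n → ℂ} (h : SmoothY Φ) (h' : SmoothY Ψ) :
    SmoothY (Φ + Ψ) := ContMDiff.add h h'

theorem SmoothY.smul {Φ : PhaseY n → ℂ} (h : SmoothY Φ) (c : ℂ) : SmoothY (c • Φ) :=
  (contDiff_const_smul c).contMDiff.comp h

theorem iterate_sphereLaplacian_add {Φ Ψ : PhaseY n → ℂ} (h : SmoothY Φ) (h' : SmoothY Ψ)
    (k : ℕ) (q : ℝ × Rn n) :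
    sphereLaplacian^[k] (fun u => (Φ + Ψ) (u, q)) =
      sphereLaplacian^[k] (fun u => Φ (u, q)) + sphereLaplacian^[k] (fun u => Ψ (u, q)) := by
  induction k with
  | zero => rfl
  | succ k ih =>
    simp only [Function.iterate_succ_apply', ih]
    funext u
    have hu := ne_zero_of_mem_unit_sphere u
    have e := ((h.iterate_sphereLaplacian k).contDiffAt_radialExt q hu).of_le (m := 2)
      two_le_infty
    have e' := ((h'.iterate_sphereLaplacian k).contDiffAt_radialExt q hu).of_le (m := 2)
      two_le_infty
    simp only [sphereLaplacian, radialExt_add, Pi.add_apply]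
    exact e.laplacian_add e'

theorem iterate_sphereLaplacian_smul {Φ : PhaseY n → ℂ} (h : SmoothY Φ) (c : ℂ)
    (k : ℕ) (q : ℝ × Rn n) :
    sphereLaplacian^[k] (fun u => (c • Φ) (u, q)) =
      c • sphereLaplacian^[k] (fun u => Φ (u, q)) := by
  induction k with
  | zero => rfl
  | succ k ih =>
    simp only [Function.iterate_succ_apply', ih]
    funext u
    have hu := ne_zero_of_mem_unit_sphere u
    have e := ((h.iterate_sphereLaplacian k).contDiffAt_radialExt q hu).of_le (m := 2)
      two_le_infty
    simp only [sphereLaplacian, radialExt_smul, Pi.smul_apply]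
    exact InnerProductSpace.laplacian_smul c e

end Smoothness

section MultiDeriv

variable {n : ℕ}

theorem iterate_partialD (i : Fin n) {g h : Rn n → ℂ} (hg : ContDiff ℝ ∞ g)
    (hh : ContDiff ℝ ∞ h) (c : ℂ) (j : ℕ) :
    ContDiff ℝ ∞ ((partialD i)^[j] g) ∧
      (partialD i)^[j] (g + h) = (partialD i)^[j] g + (partialD i)^[j] h ∧
      (partialD i)^[j] (c • g) = c • (partialD i)^[j] g := by
  induction j generalizing g h with
  | zero => exact ⟨hg, rfl, rfl⟩
  | succ j ih =>
    have hs : ∀ {g : Rn n → ℂ}, ContDiff ℝ ∞ g → ContDiff ℝ ∞ (partialD i g) := fun hg =>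
      (hg.fderiv_right (m := ∞) (by simp)).clm_apply contDiff_const
    have ha : partialD i (g + h) = partialD i g + partialD i h := by
      funext x
      simp only [partialD, Pi.add_apply]
      rw [fderiv_add (hg.differentiable (by simp) x) (hh.differentiable (by simp) x)]
      rfl
    have hc : partialD i (c • g) = c • partialD i g := by
      funext x
      simp only [partialD, Pi.smul_apply]
      rw [fderiv_const_smul (hg.differentiable (by simp) x)]
      rfl
    simp only [Function.iterate_succ_apply, ha, hc]
    exact ih (hs hg) (hs hh)

theorem multiDeriv_aux (l : Fin n → ℕ) {g h : Rn n → ℂ} (hg : ContDiff ℝ ∞ g)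
    (hh : ContDiff ℝ ∞ h) (c : ℂ) :
    multiDeriv l (g + h) = multiDeriv l g + multiDeriv l h ∧
      multiDeriv l (c • g) = c • multiDeriv l g := by
  have key : ∀ L : List (Fin n), ∀ T : (Rn n → ℂ) → Rn n → ℂ,
      T = (fun g => L.foldr (fun i h => (partialD i)^[l i] h) g) →
      ContDiff ℝ ∞ (T g) ∧ ContDiff ℝ ∞ (T h) ∧ T (g + h) = T g + T h ∧ T (c • g) = c • T g := by
    intro L
    induction L with
    | nil => rintro _ rfl; exact ⟨hg, hh, rfl, rfl⟩
    | cons i L ih =>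
      rintro _ rfl
      obtain ⟨h1, h2, h3, h4⟩ := ih _ rfl
      simp only [List.foldr_cons] at h3 h4 ⊢
      rw [h3, h4]
      exact ⟨(iterate_partialD i h1 h2 c _).1, (iterate_partialD i h2 h1 c _).1,
        (iterate_partialD i h1 h2 c _).2⟩
  exact (key _ _ rfl).2.2

end MultiDeriv

section Linear

variable {n : ℕ} [n.AtLeastTwo]

theorem mixedDerivY_add (l : Fin n → ℕ) (m k : ℕ) {Φ Ψ : PhaseY n → ℂ} (h : SmoothY Φ)
    (h' : SmoothY Ψ) : mixedDerivY l m k (Φ + Ψ) = mixedDerivY l m k Φ + mixedDerivY l m k Ψ := by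
  funext ⟨u, b, a⟩
  have s := h.iterate_sphereLaplacian k
  have s' := h'.iterate_sphereLaplacian k
  have t := ((s.iteratedDeriv m).contDiff_snd u).comp (contDiff_prodMk_right b)
  have t' := ((s'.iteratedDeriv m).contDiff_snd u).comp (contDiff_prodMk_right b)
  have e := congrFun (multiDeriv_aux l t t' 0).1 a
  simp only [mixedDerivY, Pi.add_apply]
  refine Eq.trans ?_ e
  congr 1
  funext a
  have r := (s.contDiff_snd u).comp (contDiff_prodMk_left a)
  have r' := (s'.contDiff_snd u).comp (contDiff_prodMk_left a)
  have e2 := iteratedDeriv_add (n := m) (x := b) 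
    (r.contDiffAt.of_le (by exact_mod_cast le_top))
    (r'.contDiffAt.of_le (by exact_mod_cast le_top))
  refine Eq.trans ?_ e2
  congr 1
  funext b
  exact congrFun (iterate_sphereLaplacian_add h h' k (b, a)) u

theorem mixedDerivY_smul (l : Fin n → ℕ) (m k : ℕ) {Φ : PhaseY n → ℂ} (h : SmoothY Φ)
    (c : ℂ) : mixedDerivY l m k (c • Φ) = c • mixedDerivY l m k Φ := by
  funext ⟨u, b, a⟩
  have s := h.iterate_sphereLaplacian k
  have t := ((s.iteratedDeriv m).contDiff_snd u).comp (contDiff_prodMk_right b)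
  have e := congrFun (multiDeriv_aux l t t c).2 a
  simp only [mixedDerivY, Pi.smul_apply]
  refine Eq.trans ?_ e
  congr 1
  funext a
  have e2 := iteratedDeriv_const_smul_field (n := m) (x := b) c
    (fun b => sphereLaplacian^[k] (fun u => Φ (u, b, a)) u)
  refine Eq.trans ?_ e2
  congr 1
  funext b
  exact congrFun (iterate_sphereLaplacian_smul h c k (b, a)) u

theorem weightedDerivY_add_le (s r : ℕ) (l : Fin n → ℕ) (m k : ℕ) {Φ Ψ : PhaseY n → ℂ}
    (h : SmoothY Φ) (h' : SmoothY Ψ) (p : PhaseY n) :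
    weightedDerivY s r l m k (Φ + Ψ) p ≤
      weightedDerivY s r l m k Φ p + weightedDerivY s r l m k Ψ p := by
  simp only [weightedDerivY, mixedDerivY_add l m k h h', Pi.add_apply]
  rw [← mul_add]
  gcongr
  exact norm_add_le _ _

theorem weightedDerivY_smul (s r : ℕ) (l : Fin n → ℕ) (m k : ℕ) {Φ : PhaseY n → ℂ}
    (h : SmoothY Φ) (c : ℂ) (p : PhaseY n) :
    weightedDerivY s r l m k (c • Φ) p = ‖c‖ * weightedDerivY s r l m k Φ p := by
  simp only [weightedDerivY, mixedDerivY_smul l m k h c, Pi.smul_apply, norm_smul]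
  ring

end Linear

/-! ### The space `𝒮(𝕐²ⁿ)` -/

section SchwartzSpaceY

variable (n : ℕ) [n.AtLeastTwo]

/-- The linear space of all smooth functions on `𝕐²ⁿ` for which
`(1+|b|²)^{r/2} (1+|a|²)^{s/2} |∂ₐˡ ∂_bᵐ Δᵤᵏ Φ(u,b,a)|` is bounded on `𝕐²ⁿ`, for all
`s, r, m, k ∈ ℕ₀` and `l ∈ ℕ₀ⁿ`. -/
def schwartzYSubmodule : Submodule ℂ (PhaseY n → ℂ) where
  carrier := {Φ | SmoothY Φ ∧ ∀ (s r : ℕ) (l : Fin n → ℕ) (m k : ℕ),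
    BddAbove (Set.range (weightedDerivY s r l m k Φ))}
  add_mem' := by
    rintro Φ Ψ ⟨h, hb⟩ ⟨h', hb'⟩
    refine ⟨h.add h', fun s r l m k => ?_⟩
    obtain ⟨C, hC⟩ := hb s r l m k
    obtain ⟨C', hC'⟩ := hb' s r l m k
    refine ⟨C + C', ?_⟩
    rintro _ ⟨p, rfl⟩
    exact (weightedDerivY_add_le s r l m k h h' p).trans
      (add_le_add (hC ⟨p, rfl⟩) (hC' ⟨p, rfl⟩))
  zero_mem' := by
    have h0 : SmoothY (0 : PhaseY n → ℂ) := contMDiff_const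
    refine ⟨h0, fun s r l m k => ⟨0, ?_⟩⟩
    rintro _ ⟨p, rfl⟩
    have := weightedDerivY_smul s r l m k h0 0 p
    simp only [zero_smul, norm_zero, zero_mul] at this
    exact this.le
  smul_mem' := by
    rintro c Φ ⟨h, hb⟩
    refine ⟨h.smul c, fun s r l m k => ?_⟩
    obtain ⟨C, hC⟩ := hb s r l m k
    refine ⟨‖c‖ * C, ?_⟩
    rintro _ ⟨p, rfl⟩
    rw [weightedDerivY_smul s r l m k h c p]
    exact mul_le_mul_of_nonneg_left (hC ⟨p, rfl⟩) (norm_nonneg c)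

/-- The space `𝒮(𝕐²ⁿ)`. This is a type of its own, so that it does not inherit the topology of
pointwise convergence. -/
def SchwartzY : Type := schwartzYSubmodule n

namespace SchwartzY

instance : AddCommGroup (SchwartzY n) := inferInstanceAs (AddCommGroup (schwartzYSubmodule n))

instance : Module ℂ (SchwartzY n) := inferInstanceAs (Module ℂ (schwartzYSubmodule n))

instance : CoeFun (SchwartzY n) (fun _ => PhaseY n → ℂ) := ⟨fun Φ => Φ.1⟩

variable {n}

/-- The seminorm `ρ_{s,r}^{l,m,k}` on `𝒮(𝕐²ⁿ)`: the supremum over `𝕐²ⁿ` of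
`(1+|b|²)^{r/2} (1+|a|²)^{s/2} |∂ₐˡ ∂_bᵐ Δᵤᵏ Φ(u,b,a)|`. -/
def rho (s r : ℕ) (l : Fin n → ℕ) (m k : ℕ) : Seminorm ℂ (SchwartzY n) :=
  Seminorm.of (fun Φ => ⨆ p, weightedDerivY s r l m k Φ p)
    (by
      intro Φ Ψ
      have : Nontrivial (Fin n) := Fin.nontrivial_iff_two_le.2 Nat.AtLeastTwo.prop
      have : Nonempty (USphere n) := (NormedSpace.sphere_nonempty.2 zero_le_one).to_subtype
      exact ciSup_le fun p => (weightedDerivY_add_le s r l m k Φ.2.1 Ψ.2.1 p).trans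
        (add_le_add (le_ciSup (Φ.2.2 s r l m k) p) (le_ciSup (Ψ.2.2 s r l m k) p)))
    (by
      intro c Φ
      rw [Real.mul_iSup_of_nonneg (norm_nonneg c)]
      exact iSup_congr fun p => weightedDerivY_smul s r l m k Φ.2.1 c p)

/-- The family of all seminorms `ρ_{s,r}^{l,m,k}`, indexed by `(s, r, l, m, k)`. -/
def seminormFamily (n : ℕ) [n.AtLeastTwo] :
    SeminormFamily ℂ (SchwartzY n) (ℕ × ℕ × (Fin n → ℕ) × ℕ × ℕ) :=
  fun i => rho i.1 i.2.1 i.2.2.1 i.2.2.2.1 i.2.2.2.2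

/-- The topology of `𝒮(𝕐²ⁿ)` is the one defined by the family of seminorms `ρ_{s,r}^{l,m,k}`. -/
instance : TopologicalSpace (SchwartzY n) := (seminormFamily n).moduleFilterBasis.topology

theorem withSeminorms : WithSeminorms (seminormFamily n) := ⟨rfl⟩

end SchwartzY

end SchwartzSpaceY

/-! ### The seminorms of `𝒮(ℝⁿ)` and `𝒮(ℝ)` -/

/-- The seminorm `ρ_v(φ) = sup_{x ∈ ℝⁿ, |β| ≤ v} (1+|x|)^v |∂^β φ(x)|` of `φ ∈ 𝒮(ℝⁿ)`. -/
def schwartzRho {n : ℕ} (v : ℕ) (φ : 𝓢(Rn n, ℂ)) : ℝ :=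
  ⨆ p : Rn n × {β : Fin n → ℕ // ∑ i, β i ≤ v},
    (1 + ‖p.1‖) ^ v * ‖multiDeriv p.2.1 φ p.1‖

/-- The seminorm `ρ_τ(φ) = sup_{x ∈ ℝ, j ≤ τ} (1+|x|)^τ |φ^{(j)}(x)|` of `φ ∈ 𝒮(ℝ)`. -/
def schwartzRhoReal (τ : ℕ) (φ : 𝓢(ℝ, ℂ)) : ℝ :=
  ⨆ p : ℝ × {j : ℕ // j ≤ τ}, (1 + |p.1|) ^ τ * ‖iteratedDeriv p.2.1 φ p.1‖

/-! ### The directional short-time fractional Fourier transform -/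

/-- The one-dimensional kernel `K_θ(x, ξ) = C_θ exp(i ((x² + ξ²)/2 · cot θ - x ξ csc θ))`, with
`C_θ = √((1 - i cot θ)/(2π))` (principal branch), for `θ ∉ πℤ`. -/
def fracKernel₁ (θ x ξ : ℝ) : ℂ :=
  ((1 - Complex.I * (Real.cot θ : ℂ)) / (2 * (Real.pi : ℂ))) ^ (1 / 2 : ℂ) *
    Complex.exp (Complex.I *
      (((x ^ 2 + ξ ^ 2) / 2 * Real.cot θ - x * ξ * (1 / Real.sin θ) : ℝ) : ℂ))

/-- The kernel `K_α(x, ξ) = ∏ₖ K_{αₖ}(xₖ, ξₖ)` of the fractional Fourier transform of order `α`. -/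
def fracKernel {n : ℕ} (α : Fin n → ℝ) (x ξ : Rn n) : ℂ :=
  ∏ k, fracKernel₁ (α k) (x k) (ξ k)

/-- The directional short-time fractional Fourier transform
`DS_ψ^α f(u, b, a) = ∫ f(x) conj(ψ(u·x - b)) K_α(x, a) dx`. -/
def DSTFRFT {n : ℕ} (α : Fin n → ℝ) (ψ : ℝ → ℂ) (f : Rn n → ℂ) : PhaseY n → ℂ :=
  fun p => ∫ x : Rn n, f x * conj (ψ (inner ℝ (p.1 : Rn n) x - p.2.1)) * fracKernel α x p.2.2

end

/-! Let the direction range over all of ℝⁿ. The resulting function `stf` of (y, b, a) is smooth, and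
every operation in the seminorms can be moved onto the Schwartz data. A derivative in yᵢ replaces
(f, ψ) by (xᵢ f, ψ'), one in b replaces ψ by -ψ', and one in aᵢ brings out i(aᵢ cot αᵢ - xᵢ csc αᵢ).
Growing factors are removed in the same way. Since b = u·x - (u·x - b), a factor b becomes factors
uᵢ with data xᵢ f, minus the datum tψ(t) (`sum_coord_mul_stf`). Since aᵢK = cos αᵢ xᵢK + i sin αᵢ
∂K/∂xᵢ, an integration by parts turns aᵢ into data xᵢ f, ∂ᵢf and uᵢψ' (`coord_mul_stf`).

On the sphere, Δ_u g = Δg - (n-1)Dg(u) - D²g(u,u) (`sphereLaplacian_restrict`). The radial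
derivatives bring out u·x = (u·x - b) + b, so Δ_u of a transform is a combination of transforms with
powers of b as coefficients; no uᵢ occurs. As b is constant for Δ_u, the class `RadialTerm` is
stable under Δ_u. Once all Δ_u are taken, b is exchanged for the bounded uᵢ. This gives the class
`ControlledTerm`, stable under ∂_b, ∂_a and multiplication by b and aᵢ, because the uᵢ are constants
for all of these.

A weighted derivative is therefore bounded by a finite combination of transforms of (Af, Bψ) with
bounded coefficients and continuous linear A, B. Each transform is at most |∏ C_{αₖ}| ‖Af‖_{L¹}
‖Bψ‖_∞. Hence every ρ is bounded by P(f)Q(ψ) with continuous seminorms P and Q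
(`RadialTerm.exists_weightedDerivY_bound`). Membership and joint continuity follow, and so does the
explicit estimate once P and Q are dominated by ρ_v and ρ_τ. -/

noncomputable section

/-! ### The transform with direction in ℝⁿ: smoothness, and multiplication by b and by aᵢ. -/

section Transform

open MeasureTheory

variable {n : ℕ}

/-- Multiplication by the `i`-th coordinate on `𝒮(ℝⁿ)`. -/
def mulCoord (i : Fin n) : 𝓢(Rn n, ℂ) →L[ℂ] 𝓢(Rn n, ℂ) :=
  SchwartzMap.smulLeftCLM ℂ (fun x : Rn n => ((x i : ℝ) : ℂ))

theorem mulCoord_apply (i : Fin n) (F : 𝓢(Rn n, ℂ)) (x : Rn n) :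
    mulCoord i F x = (x i : ℂ) * F x := by
  have h : (fun x : Rn n => ((x i : ℝ) : ℂ)).HasTemperateGrowth :=
    (Complex.ofRealCLM.comp (EuclideanSpace.proj (𝕜 := ℝ) i)).hasTemperateGrowth
  simp [mulCoord, SchwartzMap.smulLeftCLM_apply_apply h]

/-- Multiplication by the variable on `𝒮(ℝ)`. -/
def mulVar : 𝓢(ℝ, ℂ) →L[ℂ] 𝓢(ℝ, ℂ) := SchwartzMap.smulLeftCLM ℂ (fun t : ℝ => (t : ℂ))

theorem mulVar_apply (h : 𝓢(ℝ, ℂ)) (t : ℝ) : mulVar h t = (t : ℂ) * h t := by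
  have h : (fun t : ℝ => (t : ℂ)).HasTemperateGrowth := Complex.ofRealCLM.hasTemperateGrowth
  simp [mulVar, SchwartzMap.smulLeftCLM_apply_apply h]

/-- Differentiation on `𝒮(ℝ)`. -/
abbrev derivS : 𝓢(ℝ, ℂ) →L[ℂ] 𝓢(ℝ, ℂ) := SchwartzMap.derivCLM ℂ ℂ

/-- The `i`-th partial derivative on `𝒮(ℝⁿ)`. -/
def partialS (i : Fin n) : 𝓢(Rn n, ℂ) →L[ℂ] 𝓢(Rn n, ℂ) :=
  LineDeriv.lineDerivOpCLM ℂ 𝓢(Rn n, ℂ) (EuclideanSpace.single i (1 : ℝ))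

theorem coe_partialS (i : Fin n) (F : 𝓢(Rn n, ℂ)) : ⇑(partialS i F) = partialD i F := by
  funext x
  simp [partialS, partialD, SchwartzMap.lineDerivOp_apply_eq_fderiv]

/-- The constant factor of the fractional kernel. -/
def kernelConst (α : Fin n → ℝ) : ℂ :=
  ∏ k, ((1 - Complex.I * (Real.cot (α k) : ℂ)) / (2 * (Real.pi : ℂ))) ^ (1 / 2 : ℂ)

/-- The phase of the fractional kernel. -/
def kernelPhase (α : Fin n → ℝ) (x a : Rn n) : ℝ :=
  ∑ k, ((x k ^ 2 + a k ^ 2) / 2 * Real.cot (α k) - x k * a k * (1 / Real.sin (α k)))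

theorem fracKernel_eq (α : Fin n → ℝ) (x a : Rn n) :
    fracKernel α x a = kernelConst α * Complex.exp (Complex.I * (kernelPhase α x a : ℂ)) := by
  simp only [fracKernel, fracKernel₁, kernelConst, kernelPhase, Finset.prod_mul_distrib,
    ← Complex.exp_sum, Complex.ofReal_sum, Finset.mul_sum]

theorem norm_fracKernel (α : Fin n → ℝ) (x a : Rn n) :
    ‖fracKernel α x a‖ = ‖kernelConst α‖ := by
  rw [fracKernel_eq, norm_mul, mul_comm Complex.I, Complex.norm_exp_ofReal_mul_I, mul_one]

/-- Turns the derivative of the kernel in `a` into its derivative in `x`, as the integration by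
parts requires. -/
theorem fracKernel_comm (α : Fin n → ℝ) (x a : Rn n) : fracKernel α x a = fracKernel α a x := by
  simp only [fracKernel_eq, kernelPhase, add_comm (x _ ^ 2), mul_comm (x _) (a _)]

theorem continuous_fracKernel (α : Fin n → ℝ) (a : Rn n) :
    Continuous fun x => fracKernel α x a := by
  simp only [fracKernel_eq, kernelPhase]
  fun_prop

/-- The coordinate functional `x ↦ xᵢ`, with values in `ℂ`. -/
def coordC (i : Fin n) : Rn n →L[ℝ] ℂ :=
  Complex.ofRealCLM.comp (EuclideanSpace.proj (𝕜 := ℝ) i)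

@[simp] theorem coordC_apply (i : Fin n) (x : Rn n) : coordC i x = (x i : ℂ) := rfl

theorem hasFDerivAt_fracKernel (α : Fin n → ℝ) (x a : Rn n) :
    HasFDerivAt (fun a => fracKernel α x a)
      (∑ i, (fracKernel α x a * (Complex.I *
        ((a i : ℂ) * Real.cot (α i) - (x i : ℂ) * (1 / Real.sin (α i) : ℝ)))) • coordC i) a := by
  have hc : ∀ i, HasFDerivAt (fun a : Rn n => (a i : ℂ)) (coordC i) a :=
    fun i => (coordC i).hasFDerivAt
  have h : HasFDerivAt (fun a : Rn n => ∑ k, Complex.I * (((x k : ℂ) ^ 2 + (a k : ℂ) ^ 2) / 2 *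
      Real.cot (α k) - (x k : ℂ) * (a k : ℂ) * (1 / Real.sin (α k) : ℝ)))
      (∑ i, (Complex.I * ((a i : ℂ) * Real.cot (α i) - (x i : ℂ) * (1 / Real.sin (α i) : ℝ))) •
        coordC i) a := by
    refine HasFDerivAt.fun_sum fun i _ => ?_
    have h2 := (((((hc i).pow 2).const_add ((x i : ℂ) ^ 2)).mul_const
      ((1 / 2 : ℂ) * Real.cot (α i))).sub
      (((hc i).const_mul (x i : ℂ)).mul_const ((1 / Real.sin (α i) : ℝ) : ℂ))).const_mul Complex.I
    refine (h2.congr_fderiv ?_).congr_of_eventuallyEq (.of_forall fun a => ?_)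
    · ext v
      simp
      ring
    · simp
      ring
  have h3 := (h.cexp).const_mul (kernelConst α)
  have e : ∀ a, Complex.I * (kernelPhase α x a : ℂ) =
      ∑ k, Complex.I * (((x k : ℂ) ^ 2 + (a k : ℂ) ^ 2) / 2 *
      Real.cot (α k) - (x k : ℂ) * (a k : ℂ) * (1 / Real.sin (α k) : ℝ)) := by
    intro a
    rw [← Finset.mul_sum, kernelPhase]
    push_cast
    rfl
  simp only [fracKernel_eq, e]
  refine h3.congr_fderiv ?_
  simp only [Finset.smul_sum, smul_smul, mul_assoc]

/-- The integrand of the transform at the point `p = (y, b, a)`. -/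
def stfIntegrand (α : Fin n → ℝ) (F : Rn n → ℂ) (h : ℝ → ℂ) (p : Rn n × ℝ × Rn n) (x : Rn n) : ℂ :=
  F x * conj (h (inner ℝ p.1 x - p.2.1)) * fracKernel α x p.2.2

/-- The directional short-time fractional Fourier transform, with direction `y ∈ ℝⁿ`. -/
def stf (α : Fin n → ℝ) (F : Rn n → ℂ) (h : ℝ → ℂ) (p : Rn n × ℝ × Rn n) : ℂ :=
  ∫ x, stfIntegrand α F h p x

theorem DSTFRFT_eq_stf (α : Fin n → ℝ) (F : Rn n → ℂ) (h : ℝ → ℂ) (p : PhaseY n) :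
    DSTFRFT α h F p = stf α F h ((p.1 : Rn n), p.2) := rfl

variable (α : Fin n → ℝ) (F : 𝓢(Rn n, ℂ)) (h : 𝓢(ℝ, ℂ))

theorem continuous_stfIntegrand (p : Rn n × ℝ × Rn n) : Continuous (stfIntegrand α F h p) := by
  have := continuous_fracKernel α p.2.2
  have := F.continuous
  have := h.continuous
  unfold stfIntegrand
  fun_prop

/-- The phase is real, so the kernel has constant modulus. The bound does not depend on `p`; it
serves both as a dominating function and for the final estimate. -/
theorem norm_stfIntegrand_le (p : Rn n × ℝ × Rn n) (x : Rn n) :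
    ‖stfIntegrand α F h p x‖ ≤ ‖F x‖ * (SchwartzMap.seminorm ℂ 0 0 h * ‖kernelConst α‖) := by
  rw [stfIntegrand, norm_mul, norm_mul, norm_fracKernel, RCLike.norm_conj, mul_assoc]
  gcongr
  exact h.norm_le_seminorm ℂ _

theorem integrable_stfIntegrand (p : Rn n × ℝ × Rn n) : Integrable (stfIntegrand α F h p) :=
  (F.integrable.norm.mul_const _).mono' (continuous_stfIntegrand α F h p).aestronglyMeasurable
    (.of_forall (norm_stfIntegrand_le α F h p))

theorem norm_stf_le (p : Rn n × ℝ × Rn n) :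
    ‖stf α F h p‖ ≤ (∫ x, ‖F x‖) * (SchwartzMap.seminorm ℂ 0 0 h * ‖kernelConst α‖) := by
  rw [← integral_mul_const]
  exact norm_integral_le_of_norm_le (F.integrable.norm.mul_const _)
    (.of_forall (norm_stfIntegrand_le α F h p))

/-- The functional `(y, b, a) ↦ yᵢ`, with values in `ℂ`. -/
def coordY (i : Fin n) : Rn n × ℝ × Rn n →L[ℝ] ℂ := (coordC i).comp (.fst ℝ _ _)

/-- The functional `(y, b, a) ↦ b`, with values in `ℂ`. -/
def coordB : Rn n × ℝ × Rn n →L[ℝ] ℂ :=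
  Complex.ofRealCLM.comp ((ContinuousLinearMap.fst ℝ _ _).comp (.snd ℝ _ _))

/-- The functional `(y, b, a) ↦ aᵢ`, with values in `ℂ`. -/
def coordA (i : Fin n) : Rn n × ℝ × Rn n →L[ℝ] ℂ :=
  (coordC i).comp ((ContinuousLinearMap.snd ℝ _ _).comp (.snd ℝ _ _))

@[simp] theorem coordY_apply (i : Fin n) (p : Rn n × ℝ × Rn n) : coordY i p = (p.1 i : ℂ) := rfl
@[simp] theorem coordB_apply (p : Rn n × ℝ × Rn n) : coordB p = (p.2.1 : ℂ) := rfl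
@[simp] theorem coordA_apply (i : Fin n) (p : Rn n × ℝ × Rn n) : coordA i p = (p.2.2 i : ℂ) := rfl

/-- The common shape of the derivative of the transform and of its integrand. -/
def stfDeriv (I : 𝓢(Rn n, ℂ) → 𝓢(ℝ, ℂ) → (Rn n × ℝ × Rn n) → ℂ) (p : Rn n × ℝ × Rn n) :
    Rn n × ℝ × Rn n →L[ℝ] ℂ :=
  ∑ i, I (mulCoord i F) (derivS h) p • coordY i - I F (derivS h) p • coordB +
    ∑ i, (Complex.I * ((p.2.2 i : ℂ) * Real.cot (α i) * I F h p -
      (1 / Real.sin (α i) : ℝ) * I (mulCoord i F) h p)) • coordA i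

/-- A factor xᵢ brought out by the product rule is absorbed into `F`, and a derivative of `h` is
again Schwartz. Only integrands of the same kind occur, so differentiation can be iterated. -/
theorem hasFDerivAt_stfIntegrand (p : Rn n × ℝ × Rn n) (x : Rn n) :
    HasFDerivAt (fun p => stfIntegrand α F h p x)
      (stfDeriv α F h (fun F h p => stfIntegrand α F h p x) p) p := by
  have hK : HasFDerivAt (fun p : Rn n × ℝ × Rn n => fracKernel α x p.2.2) _ p :=
    (hasFDerivAt_fracKernel α x p.2.2).comp (g := fracKernel α x)
      (f := fun p : Rn n × ℝ × Rn n => p.2.2) p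
      ((ContinuousLinearMap.snd ℝ ℝ (Rn n)).comp (.snd ℝ (Rn n) _)).hasFDerivAt
  have ht : HasFDerivAt (fun p : Rn n × ℝ × Rn n => inner ℝ p.1 x - p.2.1)
      ((innerSL ℝ x).comp (.fst ℝ _ _) -
        (ContinuousLinearMap.fst ℝ _ _).comp (.snd ℝ _ _)) p := by
    have := ((innerSL ℝ x).comp (.fst ℝ _ _) -
      (ContinuousLinearMap.fst ℝ ℝ (Rn n)).comp (.snd ℝ (Rn n) _)).hasFDerivAt (x := p)
    refine this.congr_of_eventuallyEq (.of_forall fun p => ?_)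
    simp [real_inner_comm]
  have hh : HasFDerivAt (fun p : Rn n × ℝ × Rn n => conj (h (inner ℝ p.1 x - p.2.1))) _ p :=
    Complex.conjCLE.toContinuousLinearMap.hasFDerivAt.comp p
      ((h.hasDerivAt (inner ℝ p.1 x - p.2.1)).hasFDerivAt.comp p ht)
  have h1 := (hh.const_mul (F x)).mul hK
  refine h1.congr_fderiv (ContinuousLinearMap.ext fun ⟨e, β, γ⟩ => ?_)
  simp only [stfDeriv, stfIntegrand, SchwartzMap.derivCLM_apply, mulCoord_apply]
  simp only [add_apply, smul_apply, ContinuousLinearMap.comp_apply, sum_apply, sub_apply,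
    ContinuousLinearMap.coe_fst', ContinuousLinearMap.coe_snd', coordA_apply, coordB_apply,
    coordY_apply, coordC_apply, smul_eq_mul, innerSL_apply_apply,
    ContinuousLinearMap.toSpanSingleton_apply, ContinuousLinearEquiv.coe_coe,
    Complex.conjCLE_apply, Complex.real_smul, map_mul, Complex.conj_ofReal]
  have e1 : ((inner ℝ x e : ℝ) : ℂ) = ∑ i, (x i : ℂ) * (e i : ℂ) := by
    simp [PiLp.inner_apply, mul_comm]
  rw [Complex.ofReal_sub, e1, add_comm]
  simp only [Finset.mul_sum, Finset.sum_mul, sub_mul, mul_sub (F x), mul_sub (fracKernel _ _ _)]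
  congr 1
  · congr 1
    · exact Finset.sum_congr rfl fun i _ => by ring
    · ring
  · exact Finset.sum_congr rfl fun i _ => by ring

theorem hasFDerivAt_stf (p : Rn n × ℝ × Rn n) :
    HasFDerivAt (stf α F h) (stfDeriv α F h (fun F h p => stf α F h p) p) p := by
  set N : 𝓢(Rn n, ℂ) → 𝓢(ℝ, ℂ) → Rn n → ℝ := fun F h x =>
    ‖F x‖ * (SchwartzMap.seminorm ℂ 0 0 h * ‖kernelConst α‖) with hN
  have hNi : ∀ F h, Integrable (N F h) := fun F h => F.integrable.norm.mul_const _
  have hN0 : ∀ F h x, 0 ≤ N F h x := fun _ _ _ => by positivity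
  have hle : ∀ (F : 𝓢(Rn n, ℂ)) (h : 𝓢(ℝ, ℂ)) q x, ‖stfIntegrand α F h q x‖ ≤ N F h x :=
    fun F h q x => norm_stfIntegrand_le α F h q x
  have hint := fun (F : 𝓢(Rn n, ℂ)) (h : 𝓢(ℝ, ℂ)) => integrable_stfIntegrand α F h p
  have key := hasFDerivAt_integral_of_dominated_of_fderiv_le (𝕜 := ℝ) (μ := volume)
    (F := fun p x => stfIntegrand α F h p x)
    (F' := fun q x => stfDeriv α F h (fun F h p => stfIntegrand α F h p x) q)
    -- The only coefficients that vary with the point are the aᵢ, which are at most ‖p‖ + 1 on the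
    -- unit ball about `p`.
    (bound := fun x => ∑ i, N (mulCoord i F) (derivS h) x * ‖coordY i‖ +
      N F (derivS h) x * ‖coordB (n := n)‖ + ∑ i, ((‖p‖ + 1) * |Real.cot (α i)| * N F h x +
        |1 / Real.sin (α i)| * N (mulCoord i F) h x) * ‖coordA i‖)
    (ball_mem_nhds p one_pos)
    (.of_forall fun q => (continuous_stfIntegrand α F h q).aestronglyMeasurable)
    (hint F h) ?_ ?_ ?_ (.of_forall fun x q _ => hasFDerivAt_stfIntegrand α F h q x)
  · refine key.congr_fderiv ?_
    simp only [stfDeriv, stf]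
    have i1 : ∀ i, Integrable fun x => stfIntegrand α (mulCoord i F) (derivS h) p x • coordY i :=
      fun i => (hint _ _).smul_const _
    have i2 : Integrable fun x => stfIntegrand α F (derivS h) p x • coordB (n := n) :=
      (hint _ _).smul_const _
    have i3 : ∀ i, Integrable fun x => (p.2.2 i : ℂ) * Real.cot (α i) * stfIntegrand α F h p x :=
      fun i => (hint _ _).const_mul _
    have i4 : ∀ i, Integrable fun x => ((1 / Real.sin (α i) : ℝ) : ℂ) *
        stfIntegrand α (mulCoord i F) h p x := fun i => (hint _ _).const_mul _
    have i5 : ∀ i, Integrable fun x => Complex.I * ((p.2.2 i : ℂ) * Real.cot (α i) *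
        stfIntegrand α F h p x - (1 / Real.sin (α i) : ℝ) * stfIntegrand α (mulCoord i F) h p x) :=
      fun i => ((i3 i).sub (i4 i)).const_mul _
    rw [integral_add, integral_sub, integral_finsetSum _ fun i _ => i1 i,
      integral_finsetSum _ fun i _ => (i5 i).smul_const _]
    · simp only [integral_smul_const, integral_const_mul]
      congr 2
      funext i
      rw [integral_sub (i3 i) (i4 i), integral_const_mul, integral_const_mul]
    · exact integrable_finsetSum _ fun i _ => i1 i
    · exact i2
    · exact (integrable_finsetSum _ fun i _ => i1 i).sub i2
    · exact integrable_finsetSum _ fun i _ => (i5 i).smul_const _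
  · have hc := fun (F : 𝓢(Rn n, ℂ)) (h : 𝓢(ℝ, ℂ)) => continuous_stfIntegrand α F h p
    exact (((continuous_finsetSum _ fun i _ => (hc _ _).smul continuous_const).sub
      ((hc _ _).smul continuous_const)).add (continuous_finsetSum _ fun i _ =>
        (continuous_const.mul ((continuous_const.mul (hc _ _)).sub
          (continuous_const.mul (hc _ _)))).smul continuous_const)).aestronglyMeasurable
  · refine .of_forall fun x q hq => ?_
    have hq' : ‖q‖ ≤ ‖p‖ + 1 := by
      have := norm_sub_norm_le q p
      rw [mem_ball, dist_eq_norm] at hq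
      linarith
    refine (norm_add_le _ _).trans (add_le_add ((norm_sub_le _ _).trans (add_le_add ?_ ?_)) ?_)
    · refine (norm_sum_le _ _).trans (Finset.sum_le_sum fun i _ => ?_)
      rw [norm_smul]
      gcongr
      exact hle _ _ _ _
    · rw [norm_smul]
      gcongr
      exact hle _ _ _ _
    · refine (norm_sum_le _ _).trans (Finset.sum_le_sum fun i _ => ?_)
      have hqi : |q.2.2 i| ≤ ‖p‖ + 1 :=
        (PiLp.norm_apply_le q.2.2 i).trans ((norm_snd_le q.2).trans ((norm_snd_le q).trans hq'))
      rw [norm_smul, norm_mul, Complex.norm_I, one_mul]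
      gcongr
      refine (norm_sub_le _ _).trans (add_le_add ?_ ?_)
      · rw [norm_mul, norm_mul, Complex.norm_real, Complex.norm_real]
        exact mul_le_mul (mul_le_mul_of_nonneg_right hqi (abs_nonneg _)) (hle _ _ _ _)
          (norm_nonneg _) (by positivity)
      · rw [norm_mul, Complex.norm_real]
        exact mul_le_mul_of_nonneg_left (hle _ _ _ _) (abs_nonneg _)
  · refine ((integrable_finsetSum _ fun i _ => (hNi _ _).mul_const _).add
      ((hNi _ _).mul_const _)).add (integrable_finsetSum _ fun i _ =>
        (((hNi _ _).const_mul _).add ((hNi _ _).const_mul _)).mul_const _)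

/-- The derivative is made of transforms of other Schwartz data with coefficients affine in a, so
the induction runs over all `F` and `h` at once. -/
theorem contDiff_stf : ContDiff ℝ ∞ (stf α F h) := by
  rw [contDiff_infty]
  intro m
  induction m generalizing F h with
  | zero =>
    exact contDiff_zero.2 (continuous_iff_continuousAt.2 fun p =>
      (hasFDerivAt_stf α F h p).continuousAt)
  | succ m ih =>
    rw [Nat.cast_add, Nat.cast_one, contDiff_succ_iff_hasFDerivAt]
    refine ⟨_, ?_, hasFDerivAt_stf α F h⟩
    have h1 : ∀ i, ContDiff ℝ m fun p : Rn n × ℝ × Rn n => (p.2.2 i : ℂ) :=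
      fun i => (coordA i).contDiff
    exact ((ContDiff.sum fun i _ => (ih _ _).smul contDiff_const).sub
      ((ih _ _).smul contDiff_const)).add (ContDiff.sum fun i _ =>
        (contDiff_const.mul ((((h1 i).mul contDiff_const).mul (ih _ _)).sub
          (contDiff_const.mul (ih _ _)))).smul contDiff_const)

/-- Write y·x = (y·x - b) + b under the integral; the bracket is the argument of `h`. Read one way
this rewrites radial derivatives, read the other way it eliminates a factor b. -/
theorem sum_coord_mul_stf (p : Rn n × ℝ × Rn n) :
    ∑ i, (p.1 i : ℂ) * stf α (mulCoord i F) h p =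
      stf α F (mulVar h) p + (p.2.1 : ℂ) * stf α F h p := by
  simp only [stf]
  simp only [← integral_const_mul]
  rw [← integral_finsetSum _ fun i _ => (integrable_stfIntegrand α _ h p).const_mul _,
    ← integral_add (integrable_stfIntegrand α F _ p)
      ((integrable_stfIntegrand α F h p).const_mul _)]
  congr 1
  funext x
  have e1 : ((inner ℝ p.1 x : ℝ) : ℂ) = ∑ i, (p.1 i : ℂ) * (x i : ℂ) := by
    simp [PiLp.inner_apply, mul_comm]
  have e2 : ∀ i, (p.1 i : ℂ) * stfIntegrand α (mulCoord i F) h p x =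
      ((p.1 i : ℂ) * (x i : ℂ)) * stfIntegrand α F h p x := fun i => by
    simp only [stfIntegrand, mulCoord_apply]
    ring
  simp only [e2, ← Finset.sum_mul, ← e1]
  simp only [stfIntegrand, mulVar_apply, map_mul, Complex.conj_ofReal]
  rw [Complex.ofReal_sub]
  ring

/-- The derivative of the kernel in xᵢ is i(xᵢ cot αᵢ - aᵢ csc αᵢ)K. Integrate by parts, multiply by
sin αᵢ and solve for the term with aᵢ. -/
theorem coord_mul_stf (hα : ∀ k, Real.sin (α k) ≠ 0) (i : Fin n) (p : Rn n × ℝ × Rn n) :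
    (p.2.2 i : ℂ) * stf α F h p = Real.cos (α i) * stf α (mulCoord i F) h p -
      Complex.I * Real.sin (α i) * (stf α (partialS i F) h p +
        (p.1 i : ℂ) * stf α F (derivS h) p) := by
  set e : Rn n := EuclideanSpace.single i 1 with he
  have hK : ∀ x, HasFDerivAt (fun x => fracKernel α x p.2.2)
      (∑ i, (fracKernel α x p.2.2 * (Complex.I *
        ((x i : ℂ) * Real.cot (α i) - (p.2.2 i : ℂ) * (1 / Real.sin (α i) : ℝ)))) • coordC i) x := by
    intro x
    simp only [fracKernel_comm α _ p.2.2]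
    exact hasFDerivAt_fracKernel α p.2.2 x
  have hd : ∀ x, HasFDerivAt (fun x => conj (h (inner ℝ p.1 x - p.2.1)))
      (Complex.conjCLE.toContinuousLinearMap.comp ((ContinuousLinearMap.toSpanSingleton ℝ
        (deriv h (inner ℝ p.1 x - p.2.1))).comp (innerSL ℝ p.1))) x := fun x =>
    Complex.conjCLE.toContinuousLinearMap.hasFDerivAt.comp x
      ((h.hasDerivAt (inner ℝ p.1 x - p.2.1)).hasFDerivAt.comp x
        ((innerSL ℝ p.1).hasFDerivAt.sub_const p.2.1))
  have hG := fun x => (F.hasFDerivAt x).mul (hd x)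
  set G : Rn n → ℂ := F * fun x => conj (h (inner ℝ p.1 x - p.2.1)) with hGdef
  have eK : ∀ x, fderiv ℝ (fun x => fracKernel α x p.2.2) x e = fracKernel α x p.2.2 *
      (Complex.I * ((x i : ℂ) * Real.cot (α i) - (p.2.2 i : ℂ) * (1 / Real.sin (α i) : ℝ))) := by
    intro x
    rw [(hK x).fderiv, sum_apply, Finset.sum_eq_single i]
    · simp [he]
    · intro j _ hj
      simp [he, hj]
    · simp
  have eG : ∀ x, fderiv ℝ G x e * fracKernel α x p.2.2 = stfIntegrand α (partialS i F) h p x +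
      (p.1 i : ℂ) * stfIntegrand α F (derivS h) p x := by
    intro x
    rw [(hG x).fderiv, coe_partialS]
    simp only [stfIntegrand, partialD, SchwartzMap.derivCLM_apply, add_apply, smul_apply,
      ContinuousLinearMap.comp_apply, innerSL_apply_apply, smul_eq_mul,
      ContinuousLinearMap.toSpanSingleton_apply, ContinuousLinearEquiv.coe_coe,
      Complex.conjCLE_apply, Complex.real_smul, map_mul, Complex.conj_ofReal]
    have : (inner ℝ p.1 e : ℝ) = p.1 i := by simp [he, EuclideanSpace.inner_single_right]
    rw [this]
    ring
  have eGK : ∀ x, G x * fderiv ℝ (fun x => fracKernel α x p.2.2) x e =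
      Complex.I * Real.cot (α i) * stfIntegrand α (mulCoord i F) h p x -
        Complex.I * (p.2.2 i : ℂ) * (1 / Real.sin (α i) : ℝ) * stfIntegrand α F h p x := by
    intro x
    rw [eK]
    simp only [stfIntegrand, mulCoord_apply, hGdef, Pi.mul_apply]
    ring
  have hint := fun (F : 𝓢(Rn n, ℂ)) (h : 𝓢(ℝ, ℂ)) => integrable_stfIntegrand α F h p
  have i1 := hint (partialS i F) h
  have i2 := (hint F (derivS h)).const_mul (p.1 i : ℂ)
  have i3 := (hint (mulCoord i F) h).const_mul (Complex.I * Real.cot (α i))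
  have i4 := (hint F h).const_mul (Complex.I * (p.2.2 i : ℂ) * (1 / Real.sin (α i) : ℝ))
  -- Integrability of the product and of both differentiated products leaves no boundary term.
  have key := integral_mul_fderiv_eq_neg_fderiv_mul_of_integrable (𝕜 := ℂ) (μ := volume)
    (f := G) (g := fun x => fracKernel α x p.2.2) (v := e)
    (by simp only [eG]; exact i1.add i2) (by simp only [eGK]; exact i3.sub i4)
    (hint F h) (fun x _ => (hG x).differentiableAt) (fun x _ => (hK x).differentiableAt)
  simp only [eG, eGK] at key
  rw [integral_add i1 i2, integral_sub i3 i4] at key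
  simp only [integral_const_mul] at key
  simp only [stf]
  have hs : (Real.sin (α i) : ℂ) ≠ 0 := Complex.ofReal_ne_zero.2 (hα i)
  rw [Real.cot_eq_cos_div_sin, Complex.ofReal_div, Complex.ofReal_div, Complex.ofReal_one] at key
  generalize (∫ x, stfIntegrand α F h p x) = A at key ⊢
  generalize (∫ x, stfIntegrand α (mulCoord i F) h p x) = B at key ⊢
  generalize (∫ x, stfIntegrand α (partialS i F) h p x) = X at key ⊢
  generalize (∫ x, stfIntegrand α F (derivS h) p x) = Y at key ⊢
  have key' : Complex.I * (Real.cos (α i) * B - p.2.2 i * A) =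
      -(X + p.1 i * Y) * Real.sin (α i) := by
    rw [← key]
    field_simp
  linear_combination Complex.I * key' - (Real.cos (α i) * B - p.2.2 i * A) * Complex.I_sq

end Transform

/-! ### The Laplace–Beltrami operator of a restricted function and of the transform. -/

section SphereLaplacian

variable {n : ℕ}

theorem hasFDerivAt_inv_norm {E : Type*} [NormedAddCommGroup E] [InnerProductSpace ℝ E] {y : E}
    (hy : y ≠ 0) :
    HasFDerivAt (fun y : E => ‖y‖⁻¹) (-(‖y‖⁻¹ ^ 3) • innerSL ℝ y) y := by
  have hy' : ‖y‖ ≠ 0 := norm_ne_zero_iff.2 hy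
  have h1 := (hasStrictFDerivAt_norm_sq y).hasFDerivAt.sqrt (pow_ne_zero 2 hy')
  have h2 : HasFDerivAt (fun y : E => ‖y‖) _ y :=
    h1.congr_of_eventuallyEq (.of_forall fun y => (Real.sqrt_sq (norm_nonneg y)).symm)
  refine ((hasDerivAt_inv hy').comp_hasFDerivAt y h2).congr_fderiv ?_
  ext v
  rw [Real.sqrt_sq (norm_nonneg y)]
  simp
  field_simp

theorem hasFDerivAt_normalize {E : Type*} [NormedAddCommGroup E] [InnerProductSpace ℝ E] {y : E}
    (hy : y ≠ 0) : HasFDerivAt (fun y : E => ‖y‖⁻¹ • y)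
      (‖y‖⁻¹ • ContinuousLinearMap.id ℝ E +
        (-(‖y‖⁻¹ ^ 3) • innerSL ℝ y).smulRight y) y :=
  (hasFDerivAt_inv_norm hy).smul (hasFDerivAt_id y)

theorem fderiv_fderiv_apply {E : Type*} [NormedAddCommGroup E] [NormedSpace ℝ E] {g : E → ℂ}
    {x : E} (hg : ContDiffAt ℝ 2 g x) (v w : E) :
    fderiv ℝ (fderiv ℝ g) x v w = fderiv ℝ (fun y => fderiv ℝ g y w) x v := by
  have hd : DifferentiableAt ℝ (fderiv ℝ g) x :=
    (hg.fderiv_right (m := 1) one_add_one_eq_two.le).differentiableAt (by simp)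
  rw [fderiv_clm_apply hd (differentiableAt_const w)]
  simp

/-- Second-order chain rule: at a unit vector u, the map y ↦ y/‖y‖ has derivative e - ⟨u,e⟩u along
e, and second derivative -2⟨u,e⟩e - (1 - 3⟨u,e⟩²)u. -/
theorem fderiv_fderiv_normalize {E : Type*} [NormedAddCommGroup E] [InnerProductSpace ℝ E]
    {g : E → ℂ} (hg : ContDiff ℝ 2 g) {u : E} (hu : ‖u‖ = 1) {e : E} (he : ‖e‖ = 1) :
    fderiv ℝ (fderiv ℝ fun y => g (‖y‖⁻¹ • y)) u e e =
      fderiv ℝ (fderiv ℝ g) u (e - inner ℝ u e • u) (e - inner ℝ u e • u) -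
        fderiv ℝ g u ((2 * inner ℝ u e) • e + (1 - 3 * inner ℝ u e ^ 2) • u) := by
  have hu0 : u ≠ 0 := by rintro rfl; simp at hu
  have hN : ContDiffAt ℝ 2 (fun y : E => ‖y‖⁻¹ • y) u :=
    ((contDiffAt_norm ℝ hu0).inv (by simpa using hu0)).smul contDiffAt_id
  have hG : ContDiffAt ℝ 2 (fun y => g (‖y‖⁻¹ • y)) u := hg.contDiffAt.comp u hN
  have hgd : Differentiable ℝ g := hg.differentiable (by simp)
  have hgd' : Differentiable ℝ (fderiv ℝ g) :=
    (hg.fderiv_right (m := 1) one_add_one_eq_two.le).differentiable (by simp)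
  have e1 : (fun y => fderiv ℝ (fun y => g (‖y‖⁻¹ • y)) y e) =ᶠ[nhds u]
      fun y => fderiv ℝ g (‖y‖⁻¹ • y) (‖y‖⁻¹ • e - (‖y‖⁻¹ ^ 3 * innerSL ℝ e y) • y) := by
    filter_upwards [isOpen_ne.mem_nhds hu0] with y hy
    have := ((hgd (‖y‖⁻¹ • y)).hasFDerivAt.comp (f := fun y : E => ‖y‖⁻¹ • y) y
      (hasFDerivAt_normalize hy)).fderiv
    rw [Function.comp_def] at this
    rw [this]
    simp [real_inner_comm, sub_eq_add_neg]
  rw [fderiv_fderiv_apply hG, e1.fderiv_eq]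
  have hr := hasFDerivAt_inv_norm hu0
  have h1 := ((hgd' (‖u‖⁻¹ • u)).hasFDerivAt.comp (f := fun y : E => ‖y‖⁻¹ • y) u
    (hasFDerivAt_normalize hu0)).clm_apply
    ((hr.smul_const e).sub (((hr.pow 3).mul (innerSL ℝ e).hasFDerivAt).smul (hasFDerivAt_id u)))
  have h2 := congrArg (fun L => L e) h1.fderiv
  refine h2.trans ?_
  simp [hu, he, real_inner_comm]
  ring

/-- Sum the preceding formula over the standard basis, using ∑ uᵢeᵢ = u and ∑ uᵢ² = 1. The
first-order coefficient is 2 + n - 3 = n - 1; in second order, -2 + 1 copies of D²g(u,u) remain. -/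
theorem sphereLaplacian_restrict {g : Rn n → ℂ} (hg : ContDiff ℝ 2 g) (u : USphere n) :
    sphereLaplacian (fun v => g v) u =
      ∑ i, fderiv ℝ (fderiv ℝ g) u (EuclideanSpace.single i 1) (EuclideanSpace.single i 1) -
        (n - 1) * fderiv ℝ g u u - fderiv ℝ (fderiv ℝ g) u u u := by
  have hu : ‖(u : Rn n)‖ = 1 := by simp
  have hu0 : (u : Rn n) ≠ 0 := ne_zero_of_mem_unit_sphere u
  have e1 : radialExt (fun v : USphere n => g v) =ᶠ[nhds (u : Rn n)] fun y => g (‖y‖⁻¹ • y) := by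
    filter_upwards [isOpen_ne.mem_nhds hu0] with y hy
    exact radialExt_of_ne _ hy
  rw [sphereLaplacian, (InnerProductSpace.laplacian_congr_nhds e1).eq_of_nhds,
    InnerProductSpace.laplacian_eq_iteratedFDeriv_orthonormalBasis _
      (EuclideanSpace.basisFun (Fin n) ℝ)]
  have e2 : ∀ i : Fin n, inner ℝ (u : Rn n) (EuclideanSpace.single i 1) = (u : Rn n) i := by
    simp [EuclideanSpace.inner_single_right]
  simp only [iteratedFDeriv_two_apply, Matrix.cons_val_zero, Matrix.cons_val_one,
    EuclideanSpace.basisFun_apply]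
  have e3 : ∀ i : Fin n, ‖(EuclideanSpace.single i 1 : Rn n)‖ = 1 := by simp
  simp only [fun i : Fin n => fderiv_fderiv_normalize hg hu (e3 i), e2]
  set D := fderiv ℝ (fderiv ℝ g) (u : Rn n)
  set d := fderiv ℝ g (u : Rn n)
  have s1 : ∑ i, (u : Rn n) i • (EuclideanSpace.single i 1 : Rn n) = u := by
    have := (EuclideanSpace.basisFun (Fin n) ℝ).sum_repr (u : Rn n)
    simpa using this
  have s2 : ∑ i, ((u : Rn n) i : ℂ) ^ 2 = 1 := by
    have := EuclideanSpace.real_norm_sq_eq (u : Rn n)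
    rw [hu, one_pow] at this
    exact_mod_cast this.symm
  have t1 : ∑ i, ((u : Rn n) i : ℂ) * d (EuclideanSpace.single i 1) = d u := by
    have := congrArg d s1
    rw [map_sum] at this
    simpa using this
  have t2 : ∑ i, ((u : Rn n) i : ℂ) * D (EuclideanSpace.single i 1) u = D u u := by
    have := congrArg (fun v => D v u) s1
    rw [map_sum] at this
    simpa using this
  have t3 : ∑ i, ((u : Rn n) i : ℂ) * D u (EuclideanSpace.single i 1) = D u u := by
    have := congrArg (D u) s1
    rw [map_sum] at this
    simpa using this
  simp only [map_sub, map_add, map_smul, sub_apply, smul_apply, Complex.real_smul]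
  push_cast
  have t4 : ∑ i, ((u : Rn n) i : ℂ) ^ 2 * D u u = D u u := by
    rw [← Finset.sum_mul, s2, one_mul]
  have t5 : ∑ i, ((u : Rn n) i : ℂ) ^ 2 * d u = d u := by
    rw [← Finset.sum_mul, s2, one_mul]
  have t6 : ∑ _i : Fin n, d u = n * d u := by simp
  have e4 : ∀ i : Fin n, D (EuclideanSpace.single i 1) (EuclideanSpace.single i 1) -
      ((u : Rn n) i : ℂ) * D u (EuclideanSpace.single i 1) -
      ((u : Rn n) i : ℂ) * (D (EuclideanSpace.single i 1) u - ((u : Rn n) i : ℂ) * D u u) -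
      (2 * ((u : Rn n) i : ℂ) * d (EuclideanSpace.single i 1) +
        (1 - 3 * ((u : Rn n) i : ℂ) ^ 2) * d u) =
      D (EuclideanSpace.single i 1) (EuclideanSpace.single i 1) -
      ((u : Rn n) i : ℂ) * D u (EuclideanSpace.single i 1) -
      ((u : Rn n) i : ℂ) * D (EuclideanSpace.single i 1) u + ((u : Rn n) i : ℂ) ^ 2 * D u u -
      2 * (((u : Rn n) i : ℂ) * d (EuclideanSpace.single i 1)) - d u +
        3 * (((u : Rn n) i : ℂ) ^ 2 * d u) := fun i => by ring
  simp only [e4, Finset.sum_add_distrib, Finset.sum_sub_distrib, ← Finset.mul_sum, t1, t2, t3, t4,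
    t5, t6]
  ring

variable (α : Fin n → ℝ) (F : 𝓢(Rn n, ℂ)) (h : 𝓢(ℝ, ℂ))

theorem contDiff_stf_slice (q : ℝ × Rn n) : ContDiff ℝ ∞ fun y => stf α F h (y, q) :=
  (contDiff_stf α F h).comp (contDiff_id.prodMk contDiff_const)

theorem fderiv_stf_slice (q : ℝ × Rn n) (y e : Rn n) :
    fderiv ℝ (fun y => stf α F h (y, q)) y e =
      ∑ i, (e i : ℂ) * stf α (mulCoord i F) (derivS h) (y, q) := by
  rw [fderiv_slice (hasFDerivAt_stf α F h (y, q)).differentiableAt,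
    (hasFDerivAt_stf α F h (y, q)).fderiv]
  simp [stfDeriv, mul_comm]

theorem fderiv_fderiv_stf_slice (q : ℝ × Rn n) (y e e' : Rn n) :
    fderiv ℝ (fderiv ℝ (fun y => stf α F h (y, q))) y e e' =
      ∑ j, (e' j : ℂ) * ∑ i, (e i : ℂ) *
        stf α (mulCoord i (mulCoord j F)) (derivS (derivS h)) (y, q) := by
  rw [fderiv_fderiv_apply ((contDiff_stf_slice α F h q).contDiffAt.of_le two_le_infty)]
  simp only [fderiv_stf_slice]
  have hd : ∀ (j : Fin n), DifferentiableAt ℝ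
      (fun y => stf α (mulCoord j F) (derivS h) (y, q)) y := fun j =>
    (contDiff_stf_slice α _ _ q).contDiffAt.differentiableAt (by simp)
  rw [fderiv_fun_sum fun j _ => (hd j).const_mul _, sum_apply]
  refine Finset.sum_congr rfl fun j _ => ?_
  rw [fderiv_const_mul (hd j), smul_apply, fderiv_stf_slice, smul_eq_mul]

/-- Each radial derivative contributes a factor u·x, which `sum_coord_mul_stf` rewrites through the
argument of ψ and b. No coordinate of u survives as a coefficient, which makes iteration possible.
-/
theorem sphereLaplacian_stf (q : ℝ × Rn n) (u : USphere n) :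
    sphereLaplacian (fun v => stf α F h ((v : Rn n), q)) u =
      ∑ i, stf α (mulCoord i (mulCoord i F)) (derivS (derivS h)) ((u : Rn n), q) -
        (n - 1) * (stf α F (mulVar (derivS h)) ((u : Rn n), q) +
          (q.1 : ℂ) * stf α F (derivS h) ((u : Rn n), q)) -
        (stf α F (mulVar (mulVar (derivS (derivS h)))) ((u : Rn n), q) +
          2 * ((q.1 : ℂ) * stf α F (mulVar (derivS (derivS h))) ((u : Rn n), q)) +
          (q.1 : ℂ) * ((q.1 : ℂ) * stf α F (derivS (derivS h)) ((u : Rn n), q))) := by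
  rw [sphereLaplacian_restrict ((contDiff_stf_slice α F h q).of_le two_le_infty)]
  have key := fun (F : 𝓢(Rn n, ℂ)) (h : 𝓢(ℝ, ℂ)) =>
    sum_coord_mul_stf α F h ((u : Rn n), q)
  simp only [] at key
  simp only [fderiv_stf_slice, fderiv_fderiv_stf_slice, key, mul_add, Finset.sum_add_distrib,
    mul_left_comm _ (q.1 : ℂ), ← Finset.mul_sum]
  have e1 : ∀ i : Fin n, (∑ j, ((EuclideanSpace.single i (1 : ℝ) : Rn n) j : ℂ) *
      ∑ k, ((EuclideanSpace.single i (1 : ℝ) : Rn n) k : ℂ) *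
        stf α (mulCoord k (mulCoord j F)) (derivS (derivS h)) ((u : Rn n), q)) =
      stf α (mulCoord i (mulCoord i F)) (derivS (derivS h)) ((u : Rn n), q) := by
    intro i
    rw [Finset.sum_eq_single i, Finset.sum_eq_single i]
    · simp
    all_goals simp +contextual
  simp only [e1]
  ring

end SphereLaplacian

/-! ### Classes of terms stable under the operations in the seminorms, and their bounds. -/

section Terms

open MeasureTheory

variable {n : ℕ} {α : Fin n → ℝ}

/-- Maps `(f, ψ) ↦ T f ψ` built from transforms of `(A f, B ψ)` by linear combinations and
multiplication by `b`. -/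
inductive RadialTerm (α : Fin n → ℝ) : (𝓢(Rn n, ℂ) → 𝓢(ℝ, ℂ) → PhaseY n → ℂ) → Prop
  | base (A : 𝓢(Rn n, ℂ) →L[ℂ] 𝓢(Rn n, ℂ)) (B : 𝓢(ℝ, ℂ) →L[ℂ] 𝓢(ℝ, ℂ)) :
      RadialTerm α fun f ψ p => stf α (A f) (B ψ) ((p.1 : Rn n), p.2)
  | add {T T'} : RadialTerm α T → RadialTerm α T' → RadialTerm α fun f ψ p => T f ψ p + T' f ψ p
  | smul {T} (c : ℂ) : RadialTerm α T → RadialTerm α fun f ψ p => c * T f ψ p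
  | mulB {T} : RadialTerm α T → RadialTerm α fun f ψ p => (p.2.1 : ℂ) * T f ψ p

/-- Maps `(f, ψ) ↦ T f ψ` built from transforms of `(A f, B ψ)` by linear combinations and
multiplication by the coordinates of `u`. -/
inductive ControlledTerm (α : Fin n → ℝ) : (𝓢(Rn n, ℂ) → 𝓢(ℝ, ℂ) → PhaseY n → ℂ) → Prop
  | base (A : 𝓢(Rn n, ℂ) →L[ℂ] 𝓢(Rn n, ℂ)) (B : 𝓢(ℝ, ℂ) →L[ℂ] 𝓢(ℝ, ℂ)) :
      ControlledTerm α fun f ψ p => stf α (A f) (B ψ) ((p.1 : Rn n), p.2)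
  | add {T T'} : ControlledTerm α T → ControlledTerm α T' →
      ControlledTerm α fun f ψ p => T f ψ p + T' f ψ p
  | smul {T} (c : ℂ) : ControlledTerm α T → ControlledTerm α fun f ψ p => c * T f ψ p
  | mulU {T} (i : Fin n) : ControlledTerm α T →
      ControlledTerm α fun f ψ p => ((p.1 : Rn n) i : ℂ) * T f ψ p

variable {T T' : 𝓢(Rn n, ℂ) → 𝓢(ℝ, ℂ) → PhaseY n → ℂ}

theorem RadialTerm.sub (h : RadialTerm α T) (h' : RadialTerm α T') :
    RadialTerm α fun f ψ p => T f ψ p - T' f ψ p := by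
  simpa [sub_eq_add_neg] using h.add (h'.smul (-1))

theorem RadialTerm.sum {ι : Type*} (s : Finset ι)
    {T : ι → 𝓢(Rn n, ℂ) → 𝓢(ℝ, ℂ) → PhaseY n → ℂ} (h : ∀ i ∈ s, RadialTerm α (T i)) :
    RadialTerm α fun f ψ p => ∑ i ∈ s, T i f ψ p := by
  classical
  induction s using Finset.induction_on with
  -- Zero has no constructor of its own; it is obtained as 0 times a transform.
  | empty => simpa using (RadialTerm.base (α := α) 0 0).smul 0
  | insert i s hi ih =>
    simp only [Finset.sum_insert hi]
    exact (h i (by simp)).add (ih fun j hj => h j (by simp [hj]))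

theorem RadialTerm.smoothY [n.AtLeastTwo] (h : RadialTerm α T) (f : 𝓢(Rn n, ℂ)) (ψ : 𝓢(ℝ, ℂ)) :
    SmoothY (T f ψ) := by
  induction h with
  | base A B => exact .of_contDiffOn (contDiff_stf α (A f) (B ψ)).contDiffOn fun _ => rfl
  | add _ _ h1 h2 => exact h1.add h2
  | smul c _ h1 => exact h1.smul c
  | @mulB T _ h1 =>
    refine .of_contDiffOn (coordB.contDiff.contDiffOn.mul h1.contDiffOn_extY) fun p => ?_
    simp [extY_coe]

theorem RadialTerm.exists_sphereLaplacian [n.AtLeastTwo] (h : RadialTerm α T) :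
    ∃ T', RadialTerm α T' ∧ ∀ f ψ (u : USphere n) (q : ℝ × Rn n),
      sphereLaplacian (fun u => T f ψ (u, q)) u = T' f ψ (u, q) := by
  induction h with
  | base A B =>
    have hb : ∀ (C : 𝓢(Rn n, ℂ) →L[ℂ] 𝓢(Rn n, ℂ)) (D : 𝓢(ℝ, ℂ) →L[ℂ] 𝓢(ℝ, ℂ)), RadialTerm α
        fun f ψ p => stf α (C (A f)) (D (B ψ)) ((p.1 : Rn n), p.2) :=
      fun C D => .base (C.comp A) (D.comp B)
    have hr := ((RadialTerm.sum Finset.univ fun i _ => hb ((mulCoord i).comp (mulCoord i)) (derivS.comp derivS)).sub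
      (((hb (.id ℂ _) (mulVar.comp derivS)).add (hb (.id ℂ _) derivS).mulB).smul (n - 1))).sub
      (((hb (.id ℂ _) (mulVar.comp (mulVar.comp (derivS.comp derivS)))).add
        ((hb (.id ℂ _) (mulVar.comp (derivS.comp derivS))).mulB.smul 2)).add
        (hb (.id ℂ _) (derivS.comp derivS)).mulB.mulB)
    exact ⟨_, hr, fun f ψ u q => sphereLaplacian_stf α (A f) (B ψ) q u⟩
  | add h1 h2 i1 i2 =>
    obtain ⟨T1, r1, e1⟩ := i1
    obtain ⟨T2, r2, e2⟩ := i2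
    refine ⟨_, r1.add r2, fun f ψ u q => ?_⟩
    rw [← e1, ← e2]
    exact congrFun (iterate_sphereLaplacian_add (h1.smoothY f ψ) (h2.smoothY f ψ) 1 q) u
  | smul c h1 i1 =>
    obtain ⟨T1, r1, e1⟩ := i1
    refine ⟨_, r1.smul c, fun f ψ u q => ?_⟩
    rw [← e1]
    exact congrFun (iterate_sphereLaplacian_smul (h1.smoothY f ψ) c 1 q) u
  | mulB h1 i1 =>
    obtain ⟨T1, r1, e1⟩ := i1
    refine ⟨_, r1.mulB, fun f ψ u q => ?_⟩
    rw [← e1]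
    -- Only the slice at `q` matters, and there the factor b is the constant `q.1`.
    exact congrFun (iterate_sphereLaplacian_smul (h1.smoothY f ψ) q.1 1 q) u

theorem RadialTerm.exists_iterate_sphereLaplacian [n.AtLeastTwo] (h : RadialTerm α T) (k : ℕ) :
    ∃ T', RadialTerm α T' ∧ ∀ f ψ (u : USphere n) (q : ℝ × Rn n),
      sphereLaplacian^[k] (fun u => T f ψ (u, q)) u = T' f ψ (u, q) := by
  induction k with
  | zero => exact ⟨T, h, fun _ _ _ _ => rfl⟩
  | succ k ih =>
    obtain ⟨T1, r1, e1⟩ := ih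
    obtain ⟨T2, r2, e2⟩ := r1.exists_sphereLaplacian
    refine ⟨T2, r2, fun f ψ u q => ?_⟩
    rw [Function.iterate_succ_apply', ← e2]
    congr 1
    exact funext fun u => e1 f ψ u q

theorem ControlledTerm.sub (h : ControlledTerm α T) (h' : ControlledTerm α T') :
    ControlledTerm α fun f ψ p => T f ψ p - T' f ψ p := by
  simpa [sub_eq_add_neg] using h.add (h'.smul (-1))

theorem ControlledTerm.sum {ι : Type*} (s : Finset ι)
    {T : ι → 𝓢(Rn n, ℂ) → 𝓢(ℝ, ℂ) → PhaseY n → ℂ} (h : ∀ i ∈ s, ControlledTerm α (T i)) :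
    ControlledTerm α fun f ψ p => ∑ i ∈ s, T i f ψ p := by
  classical
  induction s using Finset.induction_on with
  | empty => simpa using (ControlledTerm.base (α := α) 0 0).smul 0
  | insert i s hi ih =>
    simp only [Finset.sum_insert hi]
    exact (h i (by simp)).add (ih fun j hj => h j (by simp [hj]))

/-- The unbounded b is exchanged for the bounded uᵢ, by `sum_coord_mul_stf` solved for its last
term. -/
theorem ControlledTerm.mulB (h : ControlledTerm α T) :
    ControlledTerm α fun f ψ p => (p.2.1 : ℂ) * T f ψ p := by
  induction h with
  | base A B =>
    have h1 : ControlledTerm α fun f ψ p =>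
        ∑ i, ((p.1 : Rn n) i : ℂ) * stf α (mulCoord i (A f)) (B ψ) ((p.1 : Rn n), p.2) :=
      .sum _ fun i _ => (ControlledTerm.base ((mulCoord i).comp A) B).mulU i
    convert h1.sub (.base A (mulVar.comp B)) using 4 with f ψ p
    rw [sum_coord_mul_stf α (A f) (B ψ) ((p.1 : Rn n), p.2)]
    exact (add_sub_cancel_left _ _).symm
  | add _ _ i1 i2 => simpa only [mul_add] using i1.add i2
  | smul c _ i1 => simpa only [mul_left_comm c] using i1.smul c
  | mulU i _ i1 =>
    convert i1.mulU i using 4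
    ring

theorem RadialTerm.controlledTerm (h : RadialTerm α T) : ControlledTerm α T := by
  induction h with
  | base A B => exact .base A B
  | add _ _ h1 h2 => exact h1.add h2
  | smul c _ h1 => exact h1.smul c
  | mulB _ h1 => exact h1.mulB

theorem ControlledTerm.mulA (hα : ∀ k, Real.sin (α k) ≠ 0) (h : ControlledTerm α T) (i : Fin n) :
    ControlledTerm α fun f ψ p => (p.2.2 i : ℂ) * T f ψ p := by
  induction h with
  | base A B =>
    have h1 := ((ControlledTerm.base (α := α) ((mulCoord i).comp A) B).smul (Real.cos (α i))).sub
      (((ControlledTerm.base (α := α) ((partialS i).comp A) B).add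
        ((ControlledTerm.base (α := α) A (derivS.comp B)).mulU i)).smul
          (Complex.I * Real.sin (α i)))
    convert h1 using 4 with f ψ p
    exact coord_mul_stf α (A f) (B ψ) hα i ((p.1 : Rn n), p.2)
  | add _ _ i1 i2 => simpa only [mul_add] using i1.add i2
  | smul c _ i1 => simpa only [mul_left_comm c] using i1.smul c
  | mulU j _ i1 =>
    convert i1.mulU j using 4
    ring

theorem ControlledTerm.contDiff (h : ControlledTerm α T) (f : 𝓢(Rn n, ℂ)) (ψ : 𝓢(ℝ, ℂ))
    (u : USphere n) : ContDiff ℝ ∞ fun q : ℝ × Rn n => T f ψ (u, q) := by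
  induction h with
  | base A B =>
    exact (contDiff_stf α (A f) (B ψ)).comp (contDiff_prodMk_right (𝕜 := ℝ) (n := ∞) (u : Rn n))
  | add _ _ h1 h2 => exact h1.add h2
  | smul c _ h1 => exact contDiff_const.mul h1
  | mulU i _ h1 => exact (contDiff_const (c := ((u : Rn n) i : ℂ))).mul h1

theorem ControlledTerm.contDiff_fst (h : ControlledTerm α T) (f : 𝓢(Rn n, ℂ)) (ψ : 𝓢(ℝ, ℂ))
    (u : USphere n) (a : Rn n) : ContDiff ℝ ∞ fun b : ℝ => T f ψ (u, b, a) :=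
  (h.contDiff f ψ u).comp (contDiff_prodMk_left a)

theorem ControlledTerm.contDiff_snd (h : ControlledTerm α T) (f : 𝓢(Rn n, ℂ)) (ψ : 𝓢(ℝ, ℂ))
    (u : USphere n) (b : ℝ) : ContDiff ℝ ∞ fun a : Rn n => T f ψ (u, b, a) :=
  (h.contDiff f ψ u).comp (contDiff_prodMk_right b)

theorem ControlledTerm.exists_deriv (h : ControlledTerm α T) :
    ∃ T', ControlledTerm α T' ∧ ∀ f ψ u b a,
      deriv (fun b => T f ψ (u, b, a)) b = T' f ψ (u, b, a) := by
  have hd : ∀ {T}, ControlledTerm α T → ∀ f ψ u b a,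
      DifferentiableAt ℝ (fun b => T f ψ (u, b, a)) b := fun h f ψ u b a =>
    (h.contDiff_fst f ψ u a).differentiable (by simp) b
  induction h with
  | base A B =>
    refine ⟨_, (ControlledTerm.base A (derivS.comp B)).smul (-1), fun f ψ u b a => ?_⟩
    have h1 : HasDerivAt (fun b : ℝ => ((u : Rn n), b, a)) (0, 1, 0) b :=
      (hasDerivAt_const _ _).prodMk ((hasDerivAt_id _).prodMk (hasDerivAt_const _ _))
    have h2 := (hasFDerivAt_stf α (A f) (B ψ) ((u : Rn n), b, a)).comp_hasDerivAt
      (f := fun b : ℝ => ((u : Rn n), b, a)) b h1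
    refine h2.deriv.trans ?_
    simp [stfDeriv]
  | add h1 h2 i1 i2 =>
    obtain ⟨T1, r1, e1⟩ := i1
    obtain ⟨T2, r2, e2⟩ := i2
    refine ⟨_, r1.add r2, fun f ψ u b a => ?_⟩
    rw [← e1, ← e2]
    exact deriv_add (hd h1 f ψ u b a) (hd h2 f ψ u b a)
  | smul c h1 i1 =>
    obtain ⟨T1, r1, e1⟩ := i1
    refine ⟨_, r1.smul c, fun f ψ u b a => ?_⟩
    rw [← e1]
    exact deriv_const_mul c (hd h1 f ψ u b a)
  | mulU i h1 i1 =>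
    obtain ⟨T1, r1, e1⟩ := i1
    refine ⟨_, r1.mulU i, fun f ψ u b a => ?_⟩
    rw [← e1]
    exact deriv_const_mul ((u : Rn n) i : ℂ) (hd h1 f ψ u b a)

theorem ControlledTerm.exists_iteratedDeriv (h : ControlledTerm α T) (m : ℕ) :
    ∃ T', ControlledTerm α T' ∧ ∀ f ψ u b a,
      iteratedDeriv m (fun b => T f ψ (u, b, a)) b = T' f ψ (u, b, a) := by
  induction m with
  | zero => exact ⟨T, h, fun _ _ _ _ _ => by rw [iteratedDeriv_zero]⟩
  | succ m ih =>
    obtain ⟨T1, r1, e1⟩ := ih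
    obtain ⟨T2, r2, e2⟩ := r1.exists_deriv
    refine ⟨T2, r2, fun f ψ u b a => ?_⟩
    rw [iteratedDeriv_succ, ← e2]
    congr 1
    exact funext fun b => e1 f ψ u b a

/-- Differentiating the kernel brings out a factor aᵢ, which `ControlledTerm.mulA` removes. The
integration by parts is thus used even without weights. -/
theorem ControlledTerm.exists_partialD (hα : ∀ k, Real.sin (α k) ≠ 0) (h : ControlledTerm α T)
    (i : Fin n) : ∃ T', ControlledTerm α T' ∧ ∀ f ψ u b a,
      partialD i (fun a => T f ψ (u, b, a)) a = T' f ψ (u, b, a) := by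
  have hd : ∀ {T}, ControlledTerm α T → ∀ f ψ u b a,
      DifferentiableAt ℝ (fun a => T f ψ (u, b, a)) a := fun h f ψ u b a =>
    (h.contDiff_snd f ψ u b).differentiable (by simp) a
  induction h with
  | base A B =>
    have hb := ControlledTerm.base (α := α) A B
    refine ⟨_, (((hb.mulA hα i).smul (Real.cot (α i))).sub
      ((ControlledTerm.base ((mulCoord i).comp A) B).smul (1 / Real.sin (α i) : ℝ))).smul
        Complex.I, fun f ψ u b a => ?_⟩
    have h1 : HasFDerivAt (fun a : Rn n => ((u : Rn n), b, a)) _ a :=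
      (hasFDerivAt_const (u : Rn n) a).prodMk (hasFDerivAt_prodMk_right (𝕜 := ℝ) b a)
    have h2 := (hasFDerivAt_stf α (A f) (B ψ) ((u : Rn n), b, a)).comp
      (f := fun a : Rn n => ((u : Rn n), b, a)) a h1
    have h3 := congrArg (fun L => L (EuclideanSpace.single i 1)) h2.fderiv
    refine h3.trans ?_
    simp only [stfDeriv, ContinuousLinearMap.comp_apply, ContinuousLinearMap.prod_apply, add_apply,
      sum_apply, sub_apply, smul_apply, coordA_apply, coordB_apply, coordY_apply]
    rw [Finset.sum_eq_single (s := Finset.univ) (f := fun j => (Complex.I * _) • _) i]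
    · simp
      ring
    · intro j _ hj
      simp [hj]
    · simp
  | add h1 h2 i1 i2 =>
    obtain ⟨T1, r1, e1⟩ := i1
    obtain ⟨T2, r2, e2⟩ := i2
    refine ⟨_, r1.add r2, fun f ψ u b a => ?_⟩
    rw [← e1, ← e2, partialD, fderiv_fun_add (hd h1 f ψ u b a) (hd h2 f ψ u b a)]
    rfl
  | smul c h1 i1 =>
    obtain ⟨T1, r1, e1⟩ := i1
    refine ⟨_, r1.smul c, fun f ψ u b a => ?_⟩
    rw [← e1, partialD, fderiv_const_mul (hd h1 f ψ u b a)]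
    rfl
  | mulU i h1 i1 =>
    obtain ⟨T1, r1, e1⟩ := i1
    refine ⟨_, r1.mulU i, fun f ψ u b a => ?_⟩
    rw [← e1, partialD]
    simp only []
    rw [fderiv_const_mul (hd h1 f ψ u b a)]
    rfl

theorem ControlledTerm.exists_iterate_partialD (hα : ∀ k, Real.sin (α k) ≠ 0)
    (h : ControlledTerm α T) (i : Fin n) (j : ℕ) : ∃ T', ControlledTerm α T' ∧ ∀ f ψ u b a,
      (partialD i)^[j] (fun a => T f ψ (u, b, a)) a = T' f ψ (u, b, a) := by
  induction j with
  | zero => exact ⟨T, h, fun _ _ _ _ _ => rfl⟩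
  | succ j ih =>
    obtain ⟨T1, r1, e1⟩ := ih
    obtain ⟨T2, r2, e2⟩ := r1.exists_partialD hα i
    refine ⟨T2, r2, fun f ψ u b a => ?_⟩
    rw [Function.iterate_succ_apply', ← e2]
    congr 1
    exact funext fun a => e1 f ψ u b a

theorem ControlledTerm.exists_multiDeriv (hα : ∀ k, Real.sin (α k) ≠ 0)
    (h : ControlledTerm α T) (l : Fin n → ℕ) : ∃ T', ControlledTerm α T' ∧ ∀ f ψ u b a,
      multiDeriv l (fun a => T f ψ (u, b, a)) a = T' f ψ (u, b, a) := by
  unfold multiDeriv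
  induction List.finRange n with
  | nil => exact ⟨T, h, fun _ _ _ _ _ => rfl⟩
  | cons i L ih =>
    obtain ⟨T1, r1, e1⟩ := ih
    obtain ⟨T2, r2, e2⟩ := r1.exists_iterate_partialD hα i (l i)
    refine ⟨T2, r2, fun f ψ u b a => ?_⟩
    rw [List.foldr_cons, ← e2]
    exact congrFun (congrArg _ (funext fun a => e1 f ψ u b a)) a

/-- The Laplacians are innermost in `mixedDerivY`, so they act while b is the only coefficient; the
exchange of b for the uᵢ comes before ∂_b and ∂_a. -/
theorem RadialTerm.exists_mixedDerivY [n.AtLeastTwo] (hα : ∀ k, Real.sin (α k) ≠ 0)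
    (h : RadialTerm α T) (l : Fin n → ℕ) (m k : ℕ) : ∃ T', ControlledTerm α T' ∧ ∀ f ψ,
      mixedDerivY l m k (T f ψ) = T' f ψ := by
  obtain ⟨T1, r1, e1⟩ := h.exists_iterate_sphereLaplacian k
  obtain ⟨T2, r2, e2⟩ := r1.controlledTerm.exists_iteratedDeriv m
  obtain ⟨T3, r3, e3⟩ := r2.exists_multiDeriv hα l
  refine ⟨T3, r3, fun f ψ => funext fun ⟨u, b, a⟩ => ?_⟩
  simp only [mixedDerivY, e1, e2, e3]

theorem ControlledTerm.mul_one_add_sq (h : ControlledTerm α T) (r : ℕ) :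
    ControlledTerm α fun f ψ p => ((1 + (p.2.1 : ℂ) ^ 2) ^ r) * T f ψ p := by
  induction r with
  | zero => simpa using h
  | succ r ih =>
    convert ih.add ih.mulB.mulB using 4
    ring

theorem ControlledTerm.mul_one_add_norm_sq (hα : ∀ k, Real.sin (α k) ≠ 0)
    (h : ControlledTerm α T) (s : ℕ) :
    ControlledTerm α fun f ψ p => ((1 + (‖p.2.2‖ : ℂ) ^ 2) ^ s) * T f ψ p := by
  induction s with
  | zero => simpa using h
  | succ s ih =>
    convert ih.add (.sum Finset.univ fun i _ => (ih.mulA hα i).mulA hα i) using 4 with f ψ p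
    have : (‖p.2.2‖ : ℂ) ^ 2 = ∑ i, (p.2.2 i : ℂ) ^ 2 := by
      exact_mod_cast EuclideanSpace.real_norm_sq_eq p.2.2
    simp only [← mul_assoc, ← sq, ← Finset.sum_mul, ← this]
    ring

/-- A transform is bounded by an L¹ norm times a sup norm, both continuous on Schwartz space, and
|uᵢ| ≤ 1 on the sphere. -/
theorem ControlledTerm.exists_bound (h : ControlledTerm α T) :
    ∃ (P : Seminorm ℂ 𝓢(Rn n, ℂ)) (Q : Seminorm ℂ 𝓢(ℝ, ℂ)), Continuous P ∧ Continuous Q ∧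
      ∀ f ψ p, ‖T f ψ p‖ ≤ P f * Q ψ := by
  induction h with
  | base A B =>
    have h1 : Continuous ((normSeminorm ℂ (Lp ℂ 1 (volume : Measure (Rn n)))).comp
        ((SchwartzMap.toLpCLM ℂ ℂ 1 volume).comp A).toLinearMap) :=
      continuous_norm.comp ((SchwartzMap.toLpCLM ℂ ℂ 1 volume).comp A).continuous
    have h2 : Continuous ((SchwartzMap.seminorm ℂ 0 0).comp B.toLinearMap) :=
      ((schwartz_withSeminorms ℂ ℝ ℂ).continuous_seminorm (0, 0)).comp B.continuous
    refine ⟨_, ‖kernelConst α‖₊ • (SchwartzMap.seminorm ℂ 0 0).comp B.toLinearMap, h1,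
      h2.const_smul ‖kernelConst α‖₊, fun f ψ p => ?_⟩
    refine (norm_stf_le α (A f) (B ψ) _).trans_eq ?_
    have e : ∫ x, ‖A f x‖ = ‖(A f).toLp 1 volume‖ := by
      rw [SchwartzMap.norm_toLp_one]
    rw [e, mul_comm (SchwartzMap.seminorm ℂ 0 0 (B ψ))]
    rfl
  | add _ _ i1 i2 =>
    obtain ⟨P1, Q1, hP1, hQ1, e1⟩ := i1
    obtain ⟨P2, Q2, hP2, hQ2, e2⟩ := i2
    -- P₁Q₁ + P₂Q₂ ≤ (P₁ + P₂)(Q₁ + Q₂) keeps the bound in product form.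
    refine ⟨P1 + P2, Q1 + Q2, hP1.add hP2, hQ1.add hQ2, fun f ψ p => (norm_add_le _ _).trans ?_⟩
    simp only [add_apply]
    nlinarith [e1 f ψ p, e2 f ψ p, mul_nonneg (apply_nonneg P1 f) (apply_nonneg Q2 ψ),
      mul_nonneg (apply_nonneg P2 f) (apply_nonneg Q1 ψ)]
  | smul c _ i1 =>
    obtain ⟨P1, Q1, hP1, hQ1, e1⟩ := i1
    refine ⟨‖c‖₊ • P1, Q1, hP1.const_smul ‖c‖₊, hQ1, fun f ψ p => ?_⟩
    rw [norm_mul, smul_apply, NNReal.smul_def, coe_nnnorm, smul_eq_mul, mul_assoc]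
    exact mul_le_mul_of_nonneg_left (e1 f ψ p) (norm_nonneg c)
  | mulU i _ i1 =>
    obtain ⟨P1, Q1, hP1, hQ1, e1⟩ := i1
    refine ⟨P1, Q1, hP1, hQ1, fun f ψ p => ?_⟩
    rw [norm_mul, Complex.norm_real]
    have h1 : ‖(p.1 : Rn n) i‖ ≤ 1 := (PiLp.norm_apply_le _ i).trans_eq (by simp)
    exact (mul_le_of_le_one_left (norm_nonneg _) h1).trans (e1 f ψ p)

theorem RadialTerm.exists_weightedDerivY_bound [n.AtLeastTwo] (hα : ∀ k, Real.sin (α k) ≠ 0)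
    (h : RadialTerm α T) (s r : ℕ) (l : Fin n → ℕ) (m k : ℕ) :
    ∃ (P : Seminorm ℂ 𝓢(Rn n, ℂ)) (Q : Seminorm ℂ 𝓢(ℝ, ℂ)), Continuous P ∧ Continuous Q ∧
      ∀ f ψ p, weightedDerivY s r l m k (T f ψ) p ≤ P f * Q ψ := by
  obtain ⟨T1, r1, e1⟩ := h.exists_mixedDerivY hα l m k
  obtain ⟨P, Q, hP, hQ, e2⟩ := ((r1.mul_one_add_norm_sq hα s).mul_one_add_sq r).exists_bound
  refine ⟨P, Q, hP, hQ, fun f ψ p => le_trans ?_ (e2 f ψ p)⟩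
  -- As 1 + x² ≥ 1, the exponent r/2 may be raised to r, giving a polynomial weight that the
  -- multiplication lemmas can produce.
  have key : ∀ (x : ℝ) (r : ℕ), (1 + |x| ^ 2) ^ ((r : ℝ) / 2) ≤ ‖(1 + (x : ℂ) ^ 2) ^ r‖ := by
    intro x r
    have h0 : 0 ≤ 1 + x ^ 2 := by positivity
    have e : (1 + (x : ℂ) ^ 2) ^ r = (((1 + x ^ 2) ^ r : ℝ) : ℂ) := by push_cast; rfl
    rw [e, Complex.norm_of_nonneg (pow_nonneg h0 r), sq_abs, ← Real.rpow_natCast (1 + x ^ 2) r]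
    exact Real.rpow_le_rpow_of_exponent_le (le_add_of_nonneg_right (sq_nonneg x))
      (half_le_self (Nat.cast_nonneg r))
  have k2 := key ‖p.2.2‖ s
  rw [abs_norm] at k2
  rw [weightedDerivY, e1, norm_mul, norm_mul, ← mul_assoc]
  gcongr
  exact key _ _

end Terms

/-! ### Domination of continuous seminorms by ρ_v and ρ_τ. -/

section SchwartzNorms

variable {n : ℕ}

theorem exists_le_of_continuous_seminorm {E : Type*} [NormedAddCommGroup E] [NormedSpace ℝ E]
    {R : ℕ → 𝓢(E, ℂ) → ℝ} (hR0 : ∀ v f, 0 ≤ R v f)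
    (hR : ∀ k j, ∃ C, ∀ v, k + j ≤ v → ∀ f, SchwartzMap.seminorm ℂ k j f ≤ C * R v f)
    {P : Seminorm ℂ 𝓢(E, ℂ)} (hP : Continuous P) : ∃ v C, 0 < C ∧ ∀ f, P f ≤ C * R v f := by
  obtain ⟨s, C, -, hC⟩ := Seminorm.bound_of_continuous (schwartz_withSeminorms ℂ E ℂ) P hP
  choose c hc using hR
  -- Continuity leaves finitely many pairs (k, j), and v is the largest k + j among them. The
  -- summand 1 only makes the constant positive.
  refine ⟨s.sup fun i => i.1 + i.2, C * ∑ i ∈ s, |c i.1 i.2| + 1, by positivity, fun f => ?_⟩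
  set v := s.sup fun i => i.1 + i.2
  have h1 : P f ≤ C * ∑ i ∈ s, schwartzSeminormFamily ℂ E ℂ i f := by
    refine (hC f).trans ?_
    rw [smul_apply, NNReal.smul_def, smul_eq_mul]
    gcongr
    refine (Seminorm.finset_sup_le_sum _ s f).trans_eq ?_
    rw [sum_apply]
  have h2 : ∑ i ∈ s, schwartzSeminormFamily ℂ E ℂ i f ≤ (∑ i ∈ s, |c i.1 i.2|) * R v f := by
    rw [Finset.sum_mul]
    refine Finset.sum_le_sum fun i hi => (hc i.1 i.2 v
      (Finset.le_sup (f := fun i : ℕ × ℕ => i.1 + i.2) hi) f).trans ?_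
    gcongr
    exacts [hR0 _ _, le_abs_self _]
  have h3 := mul_le_mul_of_nonneg_left h2 C.2
  have h4 := hR0 v f
  calc P f ≤ C * ((∑ i ∈ s, |c i.1 i.2|) * R v f) := h1.trans h3
    _ ≤ _ := by rw [add_mul, mul_assoc]; linarith

theorem one_add_norm_pow_mul_le {E : Type*} [NormedAddCommGroup E] [NormedSpace ℝ E] (f : 𝓢(E, ℂ))
    (v j : ℕ) : ∃ M, ∀ x, (1 + ‖x‖) ^ v * ‖iteratedFDeriv ℝ j f x‖ ≤ M :=
  ⟨_, fun x => SchwartzMap.one_add_le_sup_seminorm_apply (𝕜 := ℂ) (m := (v, j)) le_rfl le_rfl f x⟩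

theorem seminorm_le_schwartzRhoReal {k j τ : ℕ} (hτ : k + j ≤ τ) (ψ : 𝓢(ℝ, ℂ)) :
    SchwartzMap.seminorm ℂ k j ψ ≤ schwartzRhoReal τ ψ := by
  -- A real supremum is an upper bound only for a bounded family; here each order j has its own
  -- bound and there are finitely many j ≤ τ.
  have hb : BddAbove (Set.range fun p : ℝ × {j : ℕ // j ≤ τ} =>
      (1 + |p.1|) ^ τ * ‖iteratedDeriv p.2.1 ψ p.1‖) := by
    choose M hM using fun j => one_add_norm_pow_mul_le ψ τ j
    have : Finite {j : ℕ // j ≤ τ} := (Set.finite_Iic τ).to_subtype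
    obtain ⟨B, hB⟩ := (Set.finite_range fun j : {j : ℕ // j ≤ τ} => M j).bddAbove
    refine ⟨B, ?_⟩
    rintro _ ⟨p, rfl⟩
    have := hM p.2.1 p.1
    rw [norm_iteratedFDeriv_eq_norm_iteratedDeriv, Real.norm_eq_abs] at this
    exact this.trans (hB ⟨p.2, rfl⟩)
  refine SchwartzMap.seminorm_le_bound' ℂ k j ψ
    (Real.iSup_nonneg fun p => by positivity) fun x => ?_
  refine le_trans ?_ (le_ciSup hb (x, ⟨j, by omega⟩))
  gcongr
  calc |x| ^ k ≤ (1 + |x|) ^ k := by gcongr; linarith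
    _ ≤ _ := pow_le_pow_right₀ (by linarith [abs_nonneg x]) (by omega)

theorem exists_le_schwartzRhoReal {Q : Seminorm ℂ 𝓢(ℝ, ℂ)} (hQ : Continuous Q) :
    ∃ τ C, 0 < C ∧ ∀ ψ, Q ψ ≤ C * schwartzRhoReal τ ψ :=
  exists_le_of_continuous_seminorm (fun _ _ => Real.iSup_nonneg fun _ => by positivity)
    (fun _ _ => ⟨1, fun _ hv ψ => (seminorm_le_schwartzRhoReal hv ψ).trans_eq (one_mul _).symm⟩) hQ

/-- Symmetry of the second derivative. It is needed because `multiDeriv` fixes an order of the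
coordinates, while peeling off derivatives one at a time yields arbitrary orders. -/
theorem partialS_comm (i j : Fin n) (f : 𝓢(Rn n, ℂ)) :
    partialS i (partialS j f) = partialS j (partialS i f) := by
  ext x
  have h : ∀ i j, partialS i (partialS j f) x = fderiv ℝ (fderiv ℝ f) x
      (EuclideanSpace.single i 1) (EuclideanSpace.single j 1) := fun i j => by
    rw [fderiv_fderiv_apply (f.contDiffAt 2), coe_partialS, coe_partialS]
    rfl
  rw [h, h]
  exact ((f.contDiffAt 2).isSymmSndFDerivAt (by simp)).eq _ _

/-- Iterated partial derivatives along a list of indices. -/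
def partialList (L : List (Fin n)) (f : 𝓢(Rn n, ℂ)) : 𝓢(Rn n, ℂ) :=
  L.foldr (fun i g => partialS i g) f

theorem partialList_perm {L L' : List (Fin n)} (h : L.Perm L') (f : 𝓢(Rn n, ℂ)) :
    partialList L f = partialList L' f :=
  haveI : LeftCommutative fun (i : Fin n) (g : 𝓢(Rn n, ℂ)) => partialS i g :=
    ⟨fun i j g => partialS_comm i j g⟩
  h.foldr_eq f

/-- The list in which the index `i` occurs `β i` times. -/
def indexList (β : Fin n → ℕ) : List (Fin n) :=
  (List.finRange n).flatMap fun i => List.replicate (β i) i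

theorem coe_iterate_partialS (i : Fin n) (m : ℕ) (f : 𝓢(Rn n, ℂ)) :
    ⇑(partialList (List.replicate m i) f) = (partialD i)^[m] f := by
  induction m with
  | zero => rfl
  | succ m ih =>
    rw [Function.iterate_succ_apply', ← ih, ← coe_partialS]
    rfl

theorem coe_partialList_indexList (β : Fin n → ℕ) (f : 𝓢(Rn n, ℂ)) :
    ⇑(partialList (indexList β) f) = multiDeriv β f := by
  unfold indexList multiDeriv
  induction List.finRange n with
  | nil => rfl
  | cons i L ih =>
    rw [List.foldr_cons, ← ih, ← coe_iterate_partialS]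
    simp [partialList]

theorem perm_indexList_count (L : List (Fin n)) : L.Perm (indexList fun i => L.count i) := by
  rw [List.perm_iff_count]
  intro a
  rw [indexList, List.count_flatMap, ← Fin.sum_univ_def, Finset.sum_eq_single a]
  · simp
  · intro b _ hb
    simp [List.count_replicate, hb]
  · simp

theorem sum_count_eq_length (L : List (Fin n)) : ∑ i, L.count i = L.length := by
  rw [(perm_indexList_count L).length_eq, indexList, List.length_flatMap, Fin.sum_univ_def]
  simp

theorem norm_partialList_le_schwartzRho {v : ℕ} {L : List (Fin n)} (hL : L.length ≤ v)
    (f : 𝓢(Rn n, ℂ)) (x : Rn n) : (1 + ‖x‖) ^ v * ‖partialList L f x‖ ≤ schwartzRho v f := by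
  have hb : BddAbove (Set.range fun p : Rn n × {β : Fin n → ℕ // ∑ i, β i ≤ v} =>
      (1 + ‖p.1‖) ^ v * ‖multiDeriv p.2.1 f p.1‖) := by
    choose M hM using fun β => one_add_norm_pow_mul_le (partialList (indexList β) f) v 0
    have : Finite {β : Fin n → ℕ // ∑ i, β i ≤ v} := by
      refine ((Set.finite_Iic fun _ => v).subset fun β hβ i => ?_).to_subtype
      exact (Finset.single_le_sum (fun _ _ => Nat.zero_le _) (Finset.mem_univ i)).trans hβ
    obtain ⟨B, hB⟩ := (Set.finite_range
      fun β : {β : Fin n → ℕ // ∑ i, β i ≤ v} => M β).bddAbove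
    refine ⟨B, ?_⟩
    rintro _ ⟨p, rfl⟩
    have := hM p.2.1 p.1
    rw [norm_iteratedFDeriv_zero, coe_partialList_indexList] at this
    exact this.trans (hB ⟨p.2, rfl⟩)
  rw [partialList_perm (perm_indexList_count L), coe_partialList_indexList]
  exact le_ciSup hb (x, ⟨fun i => L.count i, (sum_count_eq_length L).trans_le hL⟩)

/-- From df = ∑ ∂ᵢf dxᵢ: with `S i` the map z ↦ z dxᵢ, one order of the Fréchet derivative is traded
for partial derivatives. -/
theorem seminorm_succ_le (k j : ℕ) : ∃ C, 0 ≤ C ∧ ∀ f : 𝓢(Rn n, ℂ),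
    SchwartzMap.seminorm ℂ k (j + 1) f ≤ C * ∑ i, SchwartzMap.seminorm ℂ k j (partialS i f) := by
  let S : Fin n → ℂ →L[ℝ] (Rn n →L[ℝ] ℂ) := fun i =>
    (ContinuousLinearMap.smulRightL ℝ (Rn n) ℂ) (EuclideanSpace.proj i)
  refine ⟨∑ i, ‖S i‖, by positivity, fun f => ?_⟩
  refine SchwartzMap.seminorm_le_bound ℂ _ _ f (by positivity) fun x => ?_
  have e : fderiv ℝ f = fun x => ∑ i, S i (partialS i f x) := by
    funext x
    ext v
    have hv : v = ∑ i, v i • (EuclideanSpace.single i 1 : Rn n) := by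
      have := (EuclideanSpace.basisFun (Fin n) ℝ).sum_repr v
      simpa using this.symm
    conv_lhs => rw [hv]
    simp [S, coe_partialS, partialD]
  have hc : ∀ i, ContDiff ℝ j (partialS i f) := fun i => (partialS i f).smooth j
  rw [← norm_iteratedFDeriv_fderiv, e, iteratedFDeriv_fun_sum_apply
    (f := fun i x => S i (partialS i f x))
    fun i _ => ((S i).contDiff.comp (hc i)).contDiffAt]
  refine (mul_le_mul_of_nonneg_left (norm_sum_le _ _) (by positivity)).trans ?_
  rw [Finset.mul_sum, Finset.mul_sum]
  refine Finset.sum_le_sum fun i _ => ?_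
  have h1 : ‖iteratedFDeriv ℝ j (fun x => S i (partialS i f x)) x‖ ≤
      ‖S i‖ * ‖iteratedFDeriv ℝ j (partialS i f) x‖ :=
    (S i).norm_iteratedFDeriv_comp_left (hc i).contDiffAt le_rfl
  calc ‖x‖ ^ k * ‖iteratedFDeriv ℝ j (fun x => S i (partialS i f x)) x‖
      ≤ ‖x‖ ^ k * (‖S i‖ * ‖iteratedFDeriv ℝ j (partialS i f) x‖) := by gcongr
    _ = ‖S i‖ * (‖x‖ ^ k * ‖iteratedFDeriv ℝ j (partialS i f) x‖) := by ring
    _ ≤ (∑ i, ‖S i‖) * SchwartzMap.seminorm ℂ k j (partialS i f) := by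
      gcongr
      · exact Finset.single_le_sum (f := fun i => ‖S i‖) (fun i _ => (S i).opNorm_nonneg)
          (Finset.mem_univ i)
      · exact SchwartzMap.le_seminorm ℂ k j _ x

theorem seminorm_le_of_partialList (k j : ℕ) : ∃ C, 0 ≤ C ∧ ∀ (f : 𝓢(Rn n, ℂ)) (M : ℝ),
    (∀ L : List (Fin n), L.length = j → SchwartzMap.seminorm ℂ k 0 (partialList L f) ≤ M) →
      SchwartzMap.seminorm ℂ k j f ≤ C * M := by
  induction j with
  | zero => exact ⟨1, zero_le_one, fun f M h => (h [] rfl).trans_eq (one_mul M).symm⟩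
  | succ j ih =>
    obtain ⟨C, hC0, hC⟩ := ih
    obtain ⟨C', hC0', hC'⟩ := seminorm_succ_le (n := n) k j
    refine ⟨C' * (n * C), by positivity, fun f M h => (hC' f).trans ?_⟩
    rw [mul_assoc]
    gcongr
    refine (Finset.sum_le_sum fun i _ => hC (partialS i f) M fun L hL => ?_).trans_eq
      (by simp [mul_assoc])
    -- Here ∂ᵢ acts on `f` before the derivatives in `L`, so it stands at the end of the list.
    have := h (L ++ [i]) (by simp [hL])
    simpa [partialList] using this

theorem exists_le_schwartzRho {P : Seminorm ℂ 𝓢(Rn n, ℂ)} (hP : Continuous P) :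
    ∃ v C, 0 < C ∧ ∀ f, P f ≤ C * schwartzRho v f := by
  refine exists_le_of_continuous_seminorm (fun _ _ => Real.iSup_nonneg fun _ => by positivity)
    (fun k j => ?_) hP
  obtain ⟨C, -, hC⟩ := seminorm_le_of_partialList (n := n) k j
  refine ⟨C, fun v hv f => hC f _ fun L hL => ?_⟩
  refine SchwartzMap.seminorm_le_bound ℂ k 0 _ (Real.iSup_nonneg fun _ => by positivity)
    fun x => ?_
  refine le_trans ?_ (norm_partialList_le_schwartzRho (v := v) (L := L) (by omega) f x)
  rw [norm_iteratedFDeriv_zero]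
  gcongr
  calc ‖x‖ ^ k ≤ (1 + ‖x‖) ^ k := by gcongr; linarith
    _ ≤ _ := pow_le_pow_right₀ (by linarith [norm_nonneg x]) (by omega)

end SchwartzNorms

/-! ### Sesquilinearity, membership and joint continuity. -/

section Main

open MeasureTheory

variable {n : ℕ} (α : Fin n → ℝ)

theorem DSTFRFT_add_left (f g : 𝓢(Rn n, ℂ)) (ψ : 𝓢(ℝ, ℂ)) :
    DSTFRFT α ψ (f + g : 𝓢(Rn n, ℂ)) = DSTFRFT α ψ f + DSTFRFT α ψ g := by
  funext p
  simp only [Pi.add_apply, DSTFRFT_eq_stf, stf]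
  rw [← integral_add (integrable_stfIntegrand _ _ _ _) (integrable_stfIntegrand _ _ _ _)]
  congr 1
  funext x
  simp only [stfIntegrand, add_apply]
  ring

theorem DSTFRFT_smul_left (c : ℂ) (f : 𝓢(Rn n, ℂ)) (ψ : 𝓢(ℝ, ℂ)) :
    DSTFRFT α ψ (c • f : 𝓢(Rn n, ℂ)) = c • DSTFRFT α ψ f := by
  funext p
  simp only [Pi.smul_apply, DSTFRFT_eq_stf, stf, smul_eq_mul, ← integral_const_mul]
  congr 1
  funext x
  simp only [stfIntegrand, smul_apply, smul_eq_mul]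
  ring

theorem DSTFRFT_add_right (f : 𝓢(Rn n, ℂ)) (ψ φ : 𝓢(ℝ, ℂ)) :
    DSTFRFT α (ψ + φ : 𝓢(ℝ, ℂ)) f = DSTFRFT α ψ f + DSTFRFT α φ f := by
  funext p
  simp only [Pi.add_apply, DSTFRFT_eq_stf, stf]
  rw [← integral_add (integrable_stfIntegrand _ _ _ _) (integrable_stfIntegrand _ _ _ _)]
  congr 1
  funext x
  simp only [stfIntegrand, add_apply, map_add]
  ring

theorem DSTFRFT_smul_right (c : ℂ) (f : 𝓢(Rn n, ℂ)) (ψ : 𝓢(ℝ, ℂ)) :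
    DSTFRFT α (c • ψ : 𝓢(ℝ, ℂ)) f = conj c • DSTFRFT α ψ f := by
  funext p
  simp only [Pi.smul_apply, DSTFRFT_eq_stf, stf, smul_eq_mul, ← integral_const_mul]
  congr 1
  funext x
  simp only [stfIntegrand, smul_apply, smul_eq_mul, map_mul]
  ring

theorem radialTerm_DSTFRFT : RadialTerm α fun f ψ => DSTFRFT α ψ f :=
  .base (.id ℂ _) (.id ℂ _)

variable {α} [n.AtLeastTwo]

theorem DSTFRFT_mem_schwartzYSubmodule (hα : ∀ k, Real.sin (α k) ≠ 0) (f : 𝓢(Rn n, ℂ))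
    (ψ : 𝓢(ℝ, ℂ)) : DSTFRFT α ψ f ∈ schwartzYSubmodule n := by
  refine ⟨(radialTerm_DSTFRFT α).smoothY f ψ, fun s r l m k => ?_⟩
  obtain ⟨P, Q, -, -, h⟩ := (radialTerm_DSTFRFT α).exists_weightedDerivY_bound hα s r l m k
  refine ⟨P f * Q ψ, ?_⟩
  rintro _ ⟨p, rfl⟩
  exact h f ψ p

/-- The directional short-time fractional Fourier transform as a sesquilinear map
`𝒮(ℝⁿ) × 𝒮(ℝ) → 𝒮(𝕐²ⁿ)`. -/
def dstfrftSesq (hα : ∀ k, Real.sin (α k) ≠ 0) :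
    𝓢(Rn n, ℂ) →ₗ[ℂ] 𝓢(ℝ, ℂ) →ₛₗ[starRingEnd ℂ] SchwartzY n :=
  LinearMap.mk₂'ₛₗ (RingHom.id ℂ) (starRingEnd ℂ)
    (fun f ψ => (⟨DSTFRFT α ψ f, DSTFRFT_mem_schwartzYSubmodule hα f ψ⟩ : schwartzYSubmodule n))
    (fun f g ψ => Subtype.ext (DSTFRFT_add_left α f g ψ))
    (fun c f ψ => Subtype.ext (DSTFRFT_smul_left α c f ψ))
    (fun f ψ φ => Subtype.ext (DSTFRFT_add_right α f ψ φ))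
    (fun c f ψ => Subtype.ext (DSTFRFT_smul_right α c f ψ))

theorem exists_rho_dstfrftSesq_le (hα : ∀ k, Real.sin (α k) ≠ 0) (s r : ℕ) (l : Fin n → ℕ)
    (m k : ℕ) : ∃ (P : Seminorm ℂ 𝓢(Rn n, ℂ)) (Q : Seminorm ℂ 𝓢(ℝ, ℂ)), Continuous P ∧
      Continuous Q ∧ ∀ f ψ, SchwartzY.rho s r l m k (dstfrftSesq hα f ψ) ≤ P f * Q ψ := by
  obtain ⟨P, Q, hP, hQ, h⟩ := (radialTerm_DSTFRFT α).exists_weightedDerivY_bound hα s r l m k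
  exact ⟨P, Q, hP, hQ, fun f ψ =>
    Real.iSup_le (h f ψ) (mul_nonneg (apply_nonneg P f) (apply_nonneg Q ψ))⟩

/-- A sesquilinear map into a space with topology given by seminorms is jointly continuous if each
seminorm of its values is bounded by a product of continuous seminorms. -/
theorem continuous_sesq_of_seminorm_le {E₁ E₂ E₃ ι : Type*} [AddCommGroup E₁] [Module ℂ E₁]
    [TopologicalSpace E₁] [IsTopologicalAddGroup E₁] [AddCommGroup E₂] [Module ℂ E₂]
    [TopologicalSpace E₂] [IsTopologicalAddGroup E₂] [AddCommGroup E₃] [Module ℂ E₃]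
    [TopologicalSpace E₃] {p : SeminormFamily ℂ E₃ ι} (hp : WithSeminorms p)
    (T : E₁ →ₗ[ℂ] E₂ →ₛₗ[starRingEnd ℂ] E₃)
    (hT : ∀ i, ∃ (P : Seminorm ℂ E₁) (Q : Seminorm ℂ E₂), Continuous P ∧ Continuous Q ∧
      ∀ x y, p i (T x y) ≤ P x * Q y) :
    Continuous fun q : E₁ × E₂ => T q.1 q.2 := by
  rw [continuous_iff_continuousAt]
  rintro ⟨x₀, y₀⟩
  rw [ContinuousAt, hp.tendsto_nhds]
  intro i ε hε
  obtain ⟨P, Q, hP, hQ, h⟩ := hT i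
  have hc : Continuous fun q : E₁ × E₂ =>
      P (q.1 - x₀) * Q (q.2 - y₀) + P (q.1 - x₀) * Q y₀ + P x₀ * Q (q.2 - y₀) := by fun_prop
  have h0 := (hc.tendsto (x₀, y₀)).eventually_lt_const (u := ε) (by simpa using hε)
  filter_upwards [h0] with q hq
  -- Expand about (x₀, y₀): each of the three terms contains an increment, so its bound tends to 0.
  have e : T q.1 q.2 - T x₀ y₀ =
      T (q.1 - x₀) (q.2 - y₀) + T (q.1 - x₀) y₀ + T x₀ (q.2 - y₀) := by
    simp only [map_sub, LinearMap.sub_apply]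
    abel
  rw [e]
  refine lt_of_le_of_lt ((map_add_le_add (p i) _ _).trans (add_le_add
    ((map_add_le_add (p i) _ _).trans (add_le_add (h _ _) (h _ _))) (h _ _))) hq

end Main
end

theorem theorem4p1 (n : ℕ) [n.AtLeastTwo] (α : Fin n → ℝ)
    (hα : ∀ k, α k ∈ Set.Ioo (-Real.pi) Real.pi \ {0}) :
    ∃ DS : 𝓢(Rn n, ℂ) →ₗ[ℂ] 𝓢(ℝ, ℂ) →ₛₗ[starRingEnd ℂ] SchwartzY n,
      (∀ (f : 𝓢(Rn n, ℂ)) (ψ : 𝓢(ℝ, ℂ)) (p : PhaseY n), DS f ψ p = DSTFRFT α ψ f p) ∧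
      Continuous (fun q : 𝓢(Rn n, ℂ) × 𝓢(ℝ, ℂ) => DS q.1 q.2) ∧
      ∀ (s r : ℕ) (l : Fin n → ℕ) (m k : ℕ), ∃ (v τ : ℕ) (C : ℝ), 0 < C ∧
        ∀ (f : 𝓢(Rn n, ℂ)) (ψ : 𝓢(ℝ, ℂ)),
          SchwartzY.rho s r l m k (DS f ψ) ≤ C * schwartzRho v f * schwartzRhoReal τ ψ := by
  have hs : ∀ k, Real.sin (α k) ≠ 0 := fun k h =>
    (hα k).2 ((Real.sin_eq_zero_iff_of_lt_of_lt (hα k).1.1 (hα k).1.2).1 h)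
  refine ⟨dstfrftSesq hs, fun _ _ _ => rfl, ?_, fun s r l m k => ?_⟩
  · exact continuous_sesq_of_seminorm_le SchwartzY.withSeminorms _ fun i =>
      exists_rho_dstfrftSesq_le hs i.1 i.2.1 i.2.2.1 i.2.2.2.1 i.2.2.2.2
  · obtain ⟨P, Q, hP, hQ, h⟩ := exists_rho_dstfrftSesq_le hs s r l m k
    obtain ⟨v, C₁, h₁, hP'⟩ := exists_le_schwartzRho hP
    obtain ⟨τ, C₂, h₂, hQ'⟩ := exists_le_schwartzRhoReal hQ
    refine ⟨v, τ, C₁ * C₂, mul_pos h₁ h₂, fun f ψ => (h f ψ).trans ?_⟩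
    calc P f * Q ψ ≤ (C₁ * schwartzRho v f) * (C₂ * schwartzRhoReal τ ψ) :=
          mul_le_mul (hP' f) (hQ' ψ) (apply_nonneg Q ψ) ((apply_nonneg P f).trans (hP' f))
      _ = _ := by ring
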